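/- Let $M$ be a smooth compact connected Riemannian manifold of dimension $d$, with Riemannian distance $\operatorname{dist}$ and Riemannian volume $dx$. Let $\mathcal F=\{\bar f_j\}_{j=1}^N\subset C^2(M,M)$ be uniformly expanding, i.e. $\inf_j\inf_x\|(D_x\bar f_j)^{-1}\|^{-1}>1$, and let $\mathcal G=\{\bar g_j\}_{j=1}^N\subset C^1(M,\mathbb R)$. Let $\rho>0$ be a probability density on $M$ ($\int_M\rho\,dx=1$) with $\ln\rho\in C^1(M)$. For (finite or infinite) sequences $f_k=\bar f_{\omega^f_k}$, $g_k=\bar g_{\omega^g_k}$, $k\ge 0$, put $$\hat g_k=g_k-\int_M g_k\circ f_{k-1}\circ\cdots\circ f_0\;\rho\,dx,\qquad \hat S_n=\sum_{k=0}^{n-1}\hat g_k\circ f_{k-1}\circ\cdots\circ f_0,\qquad \sigma_n^2=\int_M\hat S_n^2\,\rho\,dx .$$ For $\varepsilon>0$ and an integer $L\ge1$, an integer $D\ge0$ is called a specification constant $D_{\mathcal F}(\varepsilon,L)$ if for every infinite sequence $f_k=\bar f_{\omega_k}$ of maps in $\mathcal F$, all non-negative integers $a_0,a_1,\dots$ with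 $a_{k+1}-a_k-L\ge D$ and all points $x_k\in M$, there is $z\in M$ with $$\operatorname{dist}\big(f_{a_k+i}\circ\cdots\circ f_0(z),\,f_{a_k+i}\circ\cdots\circ f_{a_k}(x_k)\big)\le\varepsilon\qquad\text{for all }k\ge 0,\ 0\le i\le L-1 .$$ Suppose that there are $a\in(0,1)$, an integer $L\ge1$, $\varepsilon>0$ and a specification constant $D_{\mathcal F}(\varepsilon,L)$ such that $$4\,\varepsilon\,\sup_j\|D\bar g_j\|_{C^0}\le a,\qquad L\ge\frac 8a\,D_{\mathcal F}(\varepsilon,L)\,\max\|\hat g\|_\infty ,$$ and such that for each word $\overline\omega=\{(\omega^1_i,\omega^2_i)\}_{i=0}^{L}$ with entries in $\{1,\dots,N\}^2$ there is a point $x_{\overline\omega}\in M$ with $$\sum_{i=1}^{L}\hat g_{\omega^2_i}\big(\bar f_{\omega^1_{i-1}}\circ\cdots\circ\bar f_{\omega^1_0}(x_{\overline\omega})\big)\ge aL .$$ Here $\hat g_{\omega^2_i}=\bar g_{\omega^2_i}-\int_M\bar g_{\omega^2_i}\circ\bar f_{\omega^1_{i-1}}\circ\cdots\circ\bar f_{\omega^1_0}\,\rho\,dx$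 is the centered observable of the word, and $\max\|\hat g\|_\infty$ is the maximum of $\|\hat g_{\omega^2_i}\|_\infty$ over all words $\overline\omega$ and all $1\le i\le L$. Then there exists $B>0$ such that $\sigma_n^2\ge Bn$ for all $n\in\mathbb N$ and all sequences $\omega^f,\omega^g\in\{1,\dots,N\}^{\mathbb N\cup\{0\}}$. -/

import Mathlib

open MeasureTheory Bundle
open scoped Manifold ContDiff

noncomputable section

/-! ### Riemannian volume -/

section Volume

variable {d : ℕ} {M : Type*} [TopologicalSpace M] [ChartedSpace (EuclideanSpace ℝ (Fin d)) M]
  [RiemannianBundle (fun x : M => TangentSpace (𝓡 d) x)]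

/-- The coordinate vector field `∂ᵢ` of the chart at `c`, at the point with coordinates `y`. -/
def coordVector (c : M) (y : EuclideanSpace ℝ (Fin d)) (i : Fin d) :
    TangentSpace (𝓡 d) ((chartAt (EuclideanSpace ℝ (Fin d)) c).symm y) :=
  mfderiv (𝓡 d) (𝓡 d) (chartAt (EuclideanSpace ℝ (Fin d)) c).symm y
    (EuclideanSpace.single i (1 : ℝ) : EuclideanSpace ℝ (Fin d))

/-- The Gram matrix `gᵢⱼ = ⟨∂ᵢ, ∂ⱼ⟩` of the Riemannian metric in the chart at `c`. -/
def chartGram (c : M) (y : EuclideanSpace ℝ (Fin d)) : Matrix (Fin d) (Fin d) ℝ :=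
  Matrix.of fun i j => inner ℝ (coordVector c y i) (coordVector c y j)

variable [MeasurableSpace M]

/-- The measure `√(det gᵢⱼ) dy¹ ⋯ dyᵈ` on the domain of the chart at `c`, extended by zero. -/
def chartVolume (c : M) : Measure M :=
  (((volume : Measure (EuclideanSpace ℝ (Fin d))).restrict
      (chartAt (EuclideanSpace ℝ (Fin d)) c).target).withDensity
    fun y => ENNReal.ofReal (Real.sqrt (chartGram c y).det)).map
    (chartAt (EuclideanSpace ℝ (Fin d)) c).symm

variable (d M) in
/-- The Riemannian volume measure. The measures `chartVolume c` agree on the overlaps of the chart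
domains, so that their least upper bound is the measure obtained by gluing them. -/
def riemannianVolume : Measure M := ⨆ c : M, chartVolume (d := d) c

end Volume

/-! ### Sequential dynamics -/

/-- `composeFrom f j m = f_{j+m-1} ∘ ⋯ ∘ f_j` (`m` maps, starting with `f_j`). -/
def composeFrom {M : Type*} (f : ℕ → M → M) (j : ℕ) : ℕ → M → M
  | 0 => id
  | m + 1 => f (j + m) ∘ composeFrom f j m

/-- The centered observable `ĝ_k = g_k - ∫ g_k ∘ f_{k-1} ∘ ⋯ ∘ f_0 · ρ dμ`. -/
def centered {M : Type*} [MeasurableSpace M] (μ : Measure M) (ρ : M → ℝ)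
    (f : ℕ → M → M) (g : ℕ → M → ℝ) (k : ℕ) (x : M) : ℝ :=
  g k x - ∫ y, g k (composeFrom f 0 k y) * ρ y ∂μ

/-- The centered Birkhoff sum `Ŝ_n = ∑_{k<n} ĝ_k ∘ f_{k-1} ∘ ⋯ ∘ f_0`. -/
def centeredSum {M : Type*} [MeasurableSpace M] (μ : Measure M) (ρ : M → ℝ)
    (f : ℕ → M → M) (g : ℕ → M → ℝ) (n : ℕ) (x : M) : ℝ :=
  ∑ k ∈ Finset.range n, centered μ ρ f g k (composeFrom f 0 k x)

/-- The variance `σ_n² = ∫ Ŝ_n² ρ dμ`. -/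
def sigmaSq {M : Type*} [MeasurableSpace M] (μ : Measure M) (ρ : M → ℝ)
    (f : ℕ → M → M) (g : ℕ → M → ℝ) (n : ℕ) : ℝ :=
  ∫ x, (centeredSum μ ρ f g n x) ^ 2 * ρ x ∂μ

/-- The family `F` satisfies specification at scale `ε`, for orbit segments of length `L`, with
gaps of length `D`: along every sequence of maps drawn from `F`, prescribed orbit segments over the
time intervals `{a_k, …, a_k + L}`, with `a_{k+1} - a_k - L ≥ D`, are `ε`-shadowed by one orbit. -/
def HasSpecification {M : Type*} [Dist M] {N : ℕ} (F : Fin N → M → M) (ε : ℝ) (L D : ℕ) : Prop :=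
  ∀ (s : ℕ → Fin N) (a : ℕ → ℕ) (x : ℕ → M), (∀ k, a k + L + D ≤ a (k + 1)) →
    ∃ z : M, ∀ k, ∀ i < L,
      dist (composeFrom (fun m => F (s m)) 0 (a k + i + 1) z)
        (composeFrom (fun m => F (s m)) (a k) (i + 1) (x k)) ≤ ε

/-- The sequence of letters of a finite word `w_0 ⋯ w_L`; only its entries at the times
`0, …, L` are ever used (beyond `L` it is continued periodically). -/
def wordSeq {N L : ℕ} (w : Fin (L + 1) → Fin N) (k : ℕ) : Fin N := w (Fin.ofNat (L + 1) k)

end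

/-! The variance is computed exactly by a reversed martingale. Let `h_k` (`pushDensity`) be the
density of the law at time `k`, and `u_k` (`condMean`) the conditional expectation of `Ŝ_k` given
the state at time `k`. Then `d_k = u_k + ĝ_k - u_{k+1} ∘ f_k` (`martDiff`) is orthogonal to
functions of the state at time `k + 1`, whence `σ_n² = ∫ u_n² h_n + ∑_{k<n} ∫ d_k² h_k`
(`SequentialSystem.sigmaSq_eq`). Transfer operators contract a cone of log-Lipschitz functions, so
`h_k` is bounded below and `u_k` is bounded and Lipschitz, uniformly in `k` and in the sequences
(`SequentialSystem.condMean_bound`). By equicontinuity, a `d_k` or `u_k` whose oscillation exceeds a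
fixed threshold has second moment at least a fixed `β > 0` (`le_integral_sq_mul`).

If every `d_k` in a long window oscillated little, telescoping would make the oscillation of the
Birkhoff sum over that window sublinear in effect: smaller than `c₀` times its length. Specification
forbids this (`HasSpecification.mul_le_of_birkhoff_sub_le`): one orbit follows the points where the
words have large centered sums, another follows points where these sums are nonpositive, which exist
because the sums have mean zero. Taking differences removes the centering, which depends on the
starting density, so the words can be placed at any time. Of the gain `aL` per block, shadowing
costs at most half and the gap at most a quarter. Every window of a fixed length therefore adds `β`
to the variance (`exists_pos_mul_le_sigmaSq`).

The rest puts the Riemannian setting into this form. An expanding map is a covering, and lifting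
nearly shortest paths pairs its fibres with contraction (`exists_fiber_equiv`); the change of
variables in charts gives the duality of the transfer operator
(`integral_comp_mul_eq_integral_mul_transfer`); the `C²` regularity of the maps makes the Jacobian
log-Lipschitz (`exists_logLip_jacobian`). -/

/-! ### Log-Lipschitz functions and transfer operators -/

noncomputable section

section LogLipschitz

variable {M : Type*} [MetricSpace M]

/-- Positive functions whose logarithm is `a`-Lipschitz. -/
def LogLip (a : ℝ) (ψ : M → ℝ) : Prop :=
  (∀ x, 0 < ψ x) ∧ ∀ x y, ψ x ≤ Real.exp (a * dist x y) * ψ y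

theorem LogLip.of_log {a : ℝ} {ψ : M → ℝ} (hpos : ∀ x, 0 < ψ x)
    (h : ∀ x y, |Real.log (ψ x) - Real.log (ψ y)| ≤ a * dist x y) : LogLip a ψ := by
  refine ⟨hpos, fun x y => ?_⟩
  have h1 : Real.log (ψ x) ≤ a * dist x y + Real.log (ψ y) := by
    linarith [(abs_le.1 (h x y)).2]
  calc ψ x = Real.exp (Real.log (ψ x)) := (Real.exp_log (hpos x)).symm
    _ ≤ Real.exp (a * dist x y + Real.log (ψ y)) := Real.exp_le_exp.2 h1
    _ = _ := by rw [Real.exp_add, Real.exp_log (hpos y)]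

theorem LogLip.continuous {a : ℝ} {ψ : M → ℝ} (h : LogLip a ψ) : Continuous ψ := by
  have key : ∀ x y, Real.log (ψ x) - Real.log (ψ y) ≤ a * dist x y := by
    intro x y
    have := Real.log_le_log (h.1 x) (h.2 x y)
    rw [Real.log_mul (Real.exp_pos _).ne' (h.1 y).ne', Real.log_exp] at this
    linarith
  have hl : LipschitzWith (Real.toNNReal a) (fun x => Real.log (ψ x)) := by
    refine LipschitzWith.of_dist_le' fun x y => ?_
    rw [Real.dist_eq, abs_le]
    have := key y x
    rw [dist_comm] at this
    exact ⟨by linarith, key x y⟩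
  have : ψ = fun x => Real.exp (Real.log (ψ x)) := by
    funext x; rw [Real.exp_log (h.1 x)]
  rw [this]
  exact Real.continuous_exp.comp hl.continuous

theorem LogLip.mono {a b : ℝ} {ψ : M → ℝ} (h : LogLip a ψ) (hab : a ≤ b) : LogLip b ψ :=
  ⟨h.1, fun x y => (h.2 x y).trans (by
    have := (h.1 y).le
    gcongr)⟩

theorem LogLip.mul {a b : ℝ} {ψ φ : M → ℝ} (h : LogLip a ψ) (h' : LogLip b φ) :
    LogLip (a + b) (fun x => ψ x * φ x) := by
  refine ⟨fun x => mul_pos (h.1 x) (h'.1 x), fun x y => ?_⟩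
  calc ψ x * φ x ≤ (Real.exp (a * dist x y) * ψ y) * (Real.exp (b * dist x y) * φ y) := by
        have := (h.1 y).le
        exact mul_le_mul (h.2 x y) (h'.2 x y) (h'.1 x).le (by positivity)
    _ = _ := by rw [add_mul, Real.exp_add]; ring

theorem LogLip.inv {a : ℝ} {ψ : M → ℝ} (h : LogLip a ψ) : LogLip a (fun x => (ψ x)⁻¹) := by
  refine ⟨fun x => inv_pos.2 (h.1 x), fun x y => ?_⟩
  have h1 := h.2 y x
  rw [dist_comm] at h1
  have hx := h.1 x
  have hy := h.1 y
  rw [inv_le_iff_one_le_mul₀ hx, mul_right_comm, ← div_eq_mul_inv, one_le_div hy]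
  exact h1

theorem LogLip.div {a b : ℝ} {ψ φ : M → ℝ} (h : LogLip a ψ) (h' : LogLip b φ) :
    LogLip (a + b) (fun x => ψ x / φ x) := by
  simpa only [div_eq_mul_inv] using h.mul h'.inv

theorem LogLip.add {a : ℝ} {ψ φ : M → ℝ} (h : LogLip a ψ) (h' : LogLip a φ) :
    LogLip a (fun x => ψ x + φ x) :=
  ⟨fun x => add_pos (h.1 x) (h'.1 x), fun x y => by
    rw [mul_add]; exact add_le_add (h.2 x y) (h'.2 x y)⟩

theorem LogLip.const_mul {a c : ℝ} {ψ : M → ℝ} (h : LogLip a ψ) (hc : 0 < c) :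
    LogLip a (fun x => c * ψ x) :=
  ⟨fun x => mul_pos hc (h.1 x), fun x y => by
    rw [mul_left_comm]; exact mul_le_mul_of_nonneg_left (h.2 x y) hc.le⟩

theorem LogLip.of_one_le {b : ℝ} {ψ : M → ℝ} (h1 : ∀ x, 1 ≤ ψ x)
    (h : ∀ x y, |ψ x - ψ y| ≤ b * dist x y) : LogLip b ψ := by
  refine ⟨fun x => by linarith [h1 x], fun x y => ?_⟩
  have h2 := (abs_le.1 (h x y)).2
  have h3 := Real.add_one_le_exp (b * dist x y)
  have h4 : 0 ≤ b * dist x y := (abs_nonneg _).trans (h x y)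
  nlinarith [h1 y]

theorem exp_convex_bound {s t : ℝ} (hs : 0 ≤ s) (hs1 : s ≤ 1) :
    Real.exp (s * t) ≤ s * Real.exp t + (1 - s) := by
  have := convexOn_exp.2 (Set.mem_univ t) (Set.mem_univ 0) hs (sub_nonneg.2 hs1) (by ring)
  simpa using this

/-- Subtracting a small constant from a log-Lipschitz function costs little regularity. -/
theorem LogLip.sub_const {a s c : ℝ} {ψ : M → ℝ} (h : LogLip (s * a) ψ)
    (hs : 0 ≤ s) (hs1 : s < 1) (ha : 0 ≤ a) (hcψ : ∀ x, c ≤ (1 - s) * ψ x)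
    (hlt : ∀ x, c < ψ x) :
    LogLip a (fun x => ψ x - c) := by
  refine ⟨fun x => sub_pos.2 (hlt x), fun x y => ?_⟩
  have h1 := h.2 x y
  set t := a * dist x y with ht
  have ht0 : 0 ≤ t := by positivity
  rw [mul_assoc, ← ht] at h1
  have h2 := exp_convex_bound (t := t) hs hs1.le
  have h3 : 1 ≤ Real.exp t := Real.one_le_exp ht0
  have h4 := hcψ y
  have h5 := h.1 y
  -- After convexity, what remains is `c * (e^t - 1) ≤ (1 - s) * ψ y * (e^t - 1)`: the gap between
  -- `e^(s t)` and `e^t` pays for the subtracted constant.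
  nlinarith [mul_le_mul_of_nonneg_right h2 h5.le, mul_le_mul_of_nonneg_right h4 (sub_nonneg.2 h3)]

theorem LogLip.lipschitz {a δ K : ℝ} {ψ : M → ℝ} (h : LogLip a ψ) (ha : 0 ≤ a)
    (hδ : ∀ x y : M, dist x y ≤ δ) (hK : ∀ x, ψ x ≤ K) (x y : M) :
    |ψ x - ψ y| ≤ K * a * Real.exp (a * δ) * dist x y := by
  have key : ∀ x y, ψ x - ψ y ≤ K * a * Real.exp (a * δ) * dist x y := by
    intro x y
    have h1 := h.2 x y
    have ht0 : 0 ≤ a * dist x y := by positivity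
    have h3 : Real.exp (a * dist x y) - 1 ≤ a * dist x y * Real.exp (a * dist x y) := by
      have h4 := Real.add_one_le_exp (-(a * dist x y))
      have h5 : Real.exp (-(a * dist x y)) * Real.exp (a * dist x y) = 1 := by
        rw [← Real.exp_add]; simp
      nlinarith [Real.exp_pos (a * dist x y)]
    have h6 : Real.exp (a * dist x y) ≤ Real.exp (a * δ) :=
      Real.exp_le_exp.2 (mul_le_mul_of_nonneg_left (hδ x y) ha)
    have hy := h.1 y
    calc ψ x - ψ y ≤ (Real.exp (a * dist x y) - 1) * ψ y := by linarith
      _ ≤ (a * dist x y * Real.exp (a * δ)) * K := by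
          apply mul_le_mul _ (hK y) hy.le (by positivity)
          exact h3.trans (mul_le_mul_of_nonneg_left h6 ht0)
      _ = _ := by ring
  rw [abs_le]
  have := key y x
  rw [dist_comm] at this
  exact ⟨by linarith, key x y⟩

end LogLipschitz

/-! ### Transfer operators of abstract expanding maps. -/

section Transfer

variable {M : Type*}

/-- The transfer operator of `f` with Jacobian `J`. -/
def transfer (f : M → M) (J ψ : M → ℝ) (y : M) : ℝ := ∑ᶠ x : f ⁻¹' {y}, ψ x / J x

variable [MetricSpace M] [MeasurableSpace M]

/-- A finite-to-one map contracting fibres by the factor `lam`, whose transfer operator for the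
Jacobian `J` is dual to composition with respect to `μ`. -/
structure ExpandingMap (μ : Measure M) (f : M → M) (J : M → ℝ) (lam C : ℝ) : Prop where
  continuous : Continuous f
  finite_fiber : ∀ y, (f ⁻¹' {y}).Finite
  pairing : ∀ y y', ∃ e : f ⁻¹' {y} ≃ f ⁻¹' {y'}, ∀ x : f ⁻¹' {y},
    dist (x : M) (e x) ≤ lam * dist y y'
  jac : LogLip C J
  duality : ∀ φ ψ : M → ℝ, Continuous φ → Continuous ψ →
    ∫ x, φ (f x) * ψ x ∂μ = ∫ y, φ y * transfer f J ψ y ∂μ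

namespace ExpandingMap

variable {μ : Measure M} {f : M → M} {J : M → ℝ} {lam C : ℝ} (hf : ExpandingMap μ f J lam C)
include hf

theorem transfer_add (ψ φ : M → ℝ) :
    transfer f J (fun x => ψ x + φ x) = fun y => transfer f J ψ y + transfer f J φ y := by
  funext y
  have := (hf.finite_fiber y).to_subtype
  simp only [transfer, add_div]
  exact finsum_add_distrib (Set.toFinite _) (Set.toFinite _)

theorem transfer_const_mul (c : ℝ) (ψ : M → ℝ) :
    transfer f J (fun x => c * ψ x) = fun y => c * transfer f J ψ y := by
  funext y
  have := (hf.finite_fiber y).to_subtype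
  simp only [transfer, mul_div_assoc]
  exact (mul_finsum' _ _ (Set.toFinite _)).symm

theorem transfer_sub (ψ φ : M → ℝ) :
    transfer f J (fun x => ψ x - φ x) = fun y => transfer f J ψ y - transfer f J φ y := by
  have h := hf.transfer_add ψ (fun x => (-1) * φ x)
  rw [hf.transfer_const_mul] at h
  convert h using 2
  · funext x; ring
  · ring

/-- The weight `ψ / J` has constant `a + C`. The sums over two fibres are compared term by term
along the pairing, and paired points are closer than the base points by the factor `lam`. -/
theorem transfer_logLip {a : ℝ} (ha : 0 ≤ a + C) {ψ : M → ℝ} (hψ : LogLip a ψ) :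
    LogLip (lam * (a + C)) (transfer f J ψ) := by
  have hw := hψ.div hf.jac
  refine ⟨fun y => ?_, fun y y' => ?_⟩
  -- Surjectivity comes from the pairing: the fibre over `f y` contains `y`, so the fibre over `y`
  -- is nonempty.
  · obtain ⟨e, -⟩ := hf.pairing (f y) y
    have := (hf.finite_fiber y).fintype
    have : Nonempty (f ⁻¹' {y}) := ⟨e ⟨y, rfl⟩⟩
    rw [transfer, finsum_eq_sum_of_fintype]
    exact Finset.sum_pos (fun x _ => hw.1 x) Finset.univ_nonempty
  · obtain ⟨e, he⟩ := hf.pairing y y'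
    have := (hf.finite_fiber y).fintype
    have := (hf.finite_fiber y').fintype
    rw [transfer, transfer, finsum_eq_sum_of_fintype, finsum_eq_sum_of_fintype,
      ← Equiv.sum_comp e, Finset.mul_sum]
    refine Finset.sum_le_sum fun x _ => (hw.2 x (e x)).trans ?_
    have h1 := (hw.1 (e x)).le
    refine mul_le_mul_of_nonneg_right (Real.exp_le_exp.2 ?_) h1
    calc (a + C) * dist (x : M) (e x) ≤ (a + C) * (lam * dist y y') :=
          mul_le_mul_of_nonneg_left (he x) ha
      _ = _ := by ring

theorem integral_transfer {ψ : M → ℝ} (hψ : Continuous ψ) :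
    ∫ y, transfer f J ψ y ∂μ = ∫ x, ψ x ∂μ := by
  have := hf.duality (fun _ => 1) ψ continuous_const hψ
  simpa using this.symm

end ExpandingMap

end Transfer

/-! ### Comparison with the mean on compact spaces. -/

section Compact

variable {M : Type*} [MetricSpace M] [CompactSpace M] [MeasurableSpace M] [BorelSpace M]
  {μ : Measure M} [IsFiniteMeasure μ]

theorem Continuous.integrable_of_compact {ψ : M → ℝ} (h : Continuous ψ) : Integrable ψ μ :=
  h.integrable_of_hasCompactSupport (HasCompactSupport.of_compactSpace _)

theorem LogLip.bounds {a δ : ℝ} {ψ : M → ℝ} (h : LogLip a ψ) (ha : 0 ≤ a)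
    (hδ : ∀ x y : M, dist x y ≤ δ) (x : M) :
    ψ x * μ.real Set.univ ≤ Real.exp (a * δ) * ∫ y, ψ y ∂μ ∧
      ∫ y, ψ y ∂μ ≤ Real.exp (a * δ) * ψ x * μ.real Set.univ := by
  have key : ∀ x y, ψ x ≤ Real.exp (a * δ) * ψ y := fun x y => (h.2 x y).trans
    (mul_le_mul_of_nonneg_right (Real.exp_le_exp.2 (mul_le_mul_of_nonneg_left (hδ x y) ha))
      (h.1 y).le)
  have hi : Integrable ψ μ := h.continuous.integrable_of_compact
  constructor
  · have := integral_mono (μ := μ) (integrable_const (ψ x)) (hi.const_mul (Real.exp (a * δ)))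
      (fun y => key x y)
    rw [integral_const, integral_const_mul, smul_eq_mul] at this
    linarith
  · have := integral_mono (μ := μ) hi (integrable_const (Real.exp (a * δ) * ψ x))
      (fun y => key y x)
    rw [integral_const, smul_eq_mul] at this
    linarith

/-- One application of the transfer operator splits off a fixed proportion of the constants. -/
theorem ExpandingMap.transfer_split {f : M → M} {J : M → ℝ} {lam C a s δ : ℝ}
    (hf : ExpandingMap μ f J lam C)
    (hC : 0 ≤ C) (ha : 0 ≤ a) (hs : 0 < s) (hs1 : s < 1) (hlam : lam * (a + C) ≤ s * a)
    (hδ : ∀ x y : M, dist x y ≤ δ) (hμ : 0 < μ.real Set.univ)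
    {χ : M → ℝ} (hχ : LogLip a χ) (h1 : ∫ x, χ x ∂μ = 1) :
    ∃ χ' : M → ℝ, LogLip a χ' ∧ ∫ x, χ' x ∂μ = 1 ∧ ∀ x, transfer f J χ x =
      (1 - s) * Real.exp (-(a * δ)) / μ.real Set.univ
        + (1 - (1 - s) * Real.exp (-(a * δ))) * χ' x := by
  set V := μ.real Set.univ with hV
  have hneM : Nonempty M := by
    by_contra hne
    rw [not_nonempty_iff] at hne
    rw [Set.univ_eq_empty_iff.2 hne] at hV
    simp at hV; linarith
  obtain ⟨x0⟩ := hneM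
  have hδ0 : 0 ≤ δ := dist_nonneg.trans (hδ x0 x0)
  set E := Real.exp (-(a * δ)) with hE
  have hE0 : 0 < E := Real.exp_pos _
  have hE1 : E ≤ 1 := Real.exp_le_one_iff.2 (by have := mul_nonneg ha hδ0; linarith)
  have hEE : E * Real.exp (a * δ) = 1 := by rw [hE, ← Real.exp_add]; simp
  have hk : 0 < 1 - (1 - s) * E := by nlinarith
  have hT : LogLip (s * a) (transfer f J χ) := (hf.transfer_logLip (by linarith) hχ).mono hlam
  have hTi : ∫ x, transfer f J χ x ∂μ = 1 := (hf.integral_transfer hχ.continuous).trans h1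
  -- The transferred function has integral one and lies in the cone, so it is nowhere far below its
  -- mean. Only the fraction `1 - s` of this lower bound is removed, which is what the smaller cone
  -- constant `s * a` can absorb.
  have hlow : ∀ x, E / V ≤ transfer f J χ x := by
    intro x
    have hsa : s * a ≤ a := by nlinarith
    have := ((hT.mono hsa).bounds (μ := μ) ha hδ x).2
    rw [hTi] at this
    rw [div_le_iff₀ hμ]
    calc E = E * 1 := by ring
      _ ≤ E * (Real.exp (a * δ) * transfer f J χ x * V) := mul_le_mul_of_nonneg_left this hE0.le
      _ = (E * Real.exp (a * δ)) * (transfer f J χ x * V) := by ring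
      _ = _ := by rw [hEE, one_mul]
  have hc0 : 0 < (1 - s) * E / V := div_pos (mul_pos (by linarith) hE0) hμ
  have hcle : ∀ x, (1 - s) * E / V ≤ (1 - s) * transfer f J χ x := fun x => by
    rw [mul_div_assoc]; exact mul_le_mul_of_nonneg_left (hlow x) (by linarith)
  have hsub := hT.sub_const hs.le hs1 ha hcle fun x => by
    have := hT.1 x
    have := hcle x
    nlinarith
  refine ⟨fun x => (1 - (1 - s) * E)⁻¹ * (transfer f J χ x - (1 - s) * E / V),
    hsub.const_mul (inv_pos.2 hk), ?_, fun x => ?_⟩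
  · rw [integral_const_mul, integral_sub hT.continuous.integrable_of_compact (integrable_const _),
      hTi, integral_const, smul_eq_mul, ← hV]
    field_simp
  · field_simp
    ring

end Compact

end

/-! ### Martingale decomposition along a sequence of expanding maps -/

noncomputable section

section Sequential

variable {M : Type*} [MetricSpace M] [MeasurableSpace M]

/-- The densities of the images of `ρ μ` along the sequence `f`. -/
def pushDensity (f : ℕ → M → M) (J : ℕ → M → ℝ) (ρ : M → ℝ) : ℕ → M → ℝ
  | 0 => ρ
  | k + 1 => transfer (f k) (J k) (pushDensity f J ρ k)

/-- The density of the image under `f_{k-1} ∘ ⋯ ∘ f_0` of the signed measure `Ŝ_k ρ μ`. -/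
def corrector (μ : Measure M) (ρ : M → ℝ) (f : ℕ → M → M) (J : ℕ → M → ℝ) (g : ℕ → M → ℝ) :
    ℕ → M → ℝ
  | 0 => fun _ => 0
  | k + 1 => transfer (f k) (J k) fun x =>
      corrector μ ρ f J g k x + centered μ ρ f g k x * pushDensity f J ρ k x

/-- The conditional expectation of `Ŝ_k` given `f_{k-1} ∘ ⋯ ∘ f_0`. -/
def condMean (μ : Measure M) (ρ : M → ℝ) (f : ℕ → M → M) (J : ℕ → M → ℝ) (g : ℕ → M → ℝ)
    (k : ℕ) (x : M) : ℝ :=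
  corrector μ ρ f J g k x / pushDensity f J ρ k x

/-- The reversed martingale differences of the sequence of observables. -/
def martDiff (μ : Measure M) (ρ : M → ℝ) (f : ℕ → M → M) (J : ℕ → M → ℝ) (g : ℕ → M → ℝ)
    (k : ℕ) (x : M) : ℝ :=
  condMean μ ρ f J g k x + centered μ ρ f g k x - condMean μ ρ f J g (k + 1) (f k x)

/-- A sequence of uniformly expanding maps with uniformly Lipschitz observables, and an initial
density regular enough to be kept in a cone of log-Lipschitz functions. -/
structure SequentialSystem (μ : Measure M) (ρ : M → ℝ) (f : ℕ → M → M) (J : ℕ → M → ℝ)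
    (g : ℕ → M → ℝ) (lam C a G δ : ℝ) : Prop where
  expanding : ∀ k, ExpandingMap μ (f k) (J k) lam C
  lam_nonneg : 0 ≤ lam
  lam_lt_one : lam < 1
  C_nonneg : 0 ≤ C
  a_nonneg : 0 ≤ a
  a_large : 2 * (lam * C) ≤ (1 - lam) * a
  density : LogLip a ρ
  density_one : ∫ x, ρ x ∂μ = 1
  G_nonneg : 0 ≤ G
  lipschitz : ∀ k x y, |g k x - g k y| ≤ G * dist x y
  diam : ∀ x y : M, dist x y ≤ δ
  diam_nonneg : 0 ≤ δ

variable {μ : Measure M} {ρ : M → ℝ} {f : ℕ → M → M} {J : ℕ → M → ℝ} {g : ℕ → M → ℝ}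
  {lam C a G δ : ℝ}

omit [MetricSpace M] in
theorem sum_martDiff (j n : ℕ) (x : M) :
    ∑ i ∈ Finset.range n, martDiff μ ρ f J g (j + i) (composeFrom f j i x) =
      condMean μ ρ f J g j x
        + ∑ i ∈ Finset.range n, centered μ ρ f g (j + i) (composeFrom f j i x)
        - condMean μ ρ f J g (j + n) (composeFrom f j n x) := by
  induction n with
  | zero => simp [composeFrom]
  | succ n ih =>
    rw [Finset.sum_range_succ, Finset.sum_range_succ, ih, martDiff]
    simp only [composeFrom, Function.comp_apply, ← add_assoc]
    ring

theorem continuous_composeFrom {M : Type*} [TopologicalSpace M] {f : ℕ → M → M}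
    (hf : ∀ k, Continuous (f k)) (j k : ℕ) : Continuous (composeFrom f j k) := by
  induction k with
  | zero => exact continuous_id
  | succ k ih => exact (hf _).comp ih

namespace SequentialSystem

variable (hs : SequentialSystem μ ρ f J g lam C a G δ)
include hs

theorem composeFrom_continuous (j k : ℕ) : Continuous (composeFrom f j k) :=
  continuous_composeFrom (fun k => (hs.expanding k).continuous) j k

theorem g_continuous (k : ℕ) : Continuous (g k) :=
  (LipschitzWith.of_dist_le' fun x y => by rw [Real.dist_eq]; exact hs.lipschitz k x y).continuous

theorem centered_lipschitz (k : ℕ) (x y : M) :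
    |centered μ ρ f g k x - centered μ ρ f g k y| ≤ G * dist x y := by
  simpa [centered] using hs.lipschitz k x y

theorem pushDensity_logLip (k : ℕ) : LogLip a (pushDensity f J ρ k) := by
  induction k with
  | zero => exact hs.density
  | succ k ih =>
    refine ((hs.expanding k).transfer_logLip (by linarith [hs.C_nonneg, hs.a_nonneg]) ih).mono ?_
    nlinarith [hs.a_large, hs.lam_lt_one, hs.a_nonneg, mul_nonneg hs.lam_nonneg hs.C_nonneg]

theorem pushDensity_continuous (k : ℕ) : Continuous (pushDensity f J ρ k) :=
  (hs.pushDensity_logLip k).continuous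

theorem centered_continuous (k : ℕ) : Continuous (centered μ ρ f g k) :=
  (hs.g_continuous k).sub continuous_const

theorem integral_comp_mul (k : ℕ) {φ : M → ℝ} (hφ : Continuous φ) :
    ∫ x, φ (composeFrom f 0 k x) * ρ x ∂μ = ∫ x, φ x * pushDensity f J ρ k x ∂μ := by
  induction k generalizing φ with
  | zero => rfl
  | succ k ih =>
    have h := ih (hφ.comp (hs.expanding k).continuous)
    have h' := (hs.expanding k).duality φ _ hφ (hs.pushDensity_continuous k)
    simp only [composeFrom, zero_add, Function.comp_apply] at h ⊢
    exact h.trans h'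

theorem condMean_mul (k : ℕ) (x : M) :
    condMean μ ρ f J g k x * pushDensity f J ρ k x = corrector μ ρ f J g k x :=
  div_mul_cancel₀ _ ((hs.pushDensity_logLip k).1 x).ne'

theorem pushDensity_integral (k : ℕ) : ∫ x, pushDensity f J ρ k x ∂μ = 1 := by
  have := hs.integral_comp_mul k (φ := fun _ => 1) continuous_const
  simpa [hs.density_one] using this.symm

variable [IsFiniteMeasure μ]

theorem measure_pos : 0 < μ.real Set.univ := by
  rcases (measureReal_nonneg : 0 ≤ μ.real Set.univ).lt_or_eq with h | h
  · exact h
  · exfalso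
    have h0 : μ = 0 := by
      rw [← Measure.measure_univ_eq_zero]
      exact (measureReal_eq_zero_iff).1 h.symm
    have := hs.density_one
    rw [h0] at this
    simp at this

variable [CompactSpace M] [BorelSpace M]

/-- The centering constant is an average of values of `g k` against the probability density `ρ`, so
it differs from each value by at most the oscillation. -/
theorem abs_centered_le (k : ℕ) (x : M) : |centered μ ρ f g k x| ≤ G * δ := by
  have h1 : ∀ y, |g k x - g k (composeFrom f 0 k y)| ≤ G * δ := fun y =>
    (hs.lipschitz k x _).trans (mul_le_mul_of_nonneg_left (hs.diam _ _) hs.G_nonneg)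
  have hρ : Integrable ρ μ := hs.density.continuous.integrable_of_compact
  have hgi : Integrable (fun y => g k (composeFrom f 0 k y) * ρ y) μ :=
    (((hs.g_continuous k).comp (hs.composeFrom_continuous 0 k)).mul
      hs.density.continuous).integrable_of_compact
  have hle := integral_mono hgi (hρ.const_mul (g k x + G * δ)) fun y =>
    mul_le_mul_of_nonneg_right (by linarith [(abs_le.1 (h1 y)).1]) (hs.density.1 y).le
  have hge := integral_mono (hρ.const_mul (g k x - G * δ)) hgi fun y =>
    mul_le_mul_of_nonneg_right (by linarith [(abs_le.1 (h1 y)).2]) (hs.density.1 y).le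
  rw [integral_const_mul, hs.density_one] at hle hge
  rw [centered, abs_le]
  constructor <;> linarith

theorem centered_integral (k : ℕ) :
    ∫ x, centered μ ρ f g k x * pushDensity f J ρ k x ∂μ = 0 := by
  have hi1 : Integrable (fun x => g k x * pushDensity f J ρ k x) μ :=
    ((hs.g_continuous k).mul (hs.pushDensity_continuous k)).integrable_of_compact
  have hi2 : Integrable (pushDensity f J ρ k) μ :=
    (hs.pushDensity_continuous k).integrable_of_compact
  simp only [centered, sub_mul]
  rw [integral_sub hi1 (hi2.const_mul _), integral_const_mul, hs.pushDensity_integral,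
    hs.integral_comp_mul k (hs.g_continuous k)]
  ring

/-- The source term is split as `ĝ h = (ĝ + c) h - c h`, two elements of the cone of the same mass
`c`. One transfer step splits the same constant off the positive and the negative part; these
constants cancel, and the mass `A + c` of each part shrinks by the factor `1 - kap`. The prefactor
`A` is the fixed point of this recursion, `(1 - kap) * (A + c) = A`, hence is independent of `k`. -/
theorem corrector_eq {kap : ℝ} (hkap : kap = (1 - (1 + lam) / 2) * Real.exp (-((a + G) * δ)))
    (k : ℕ) : ∃ χ₁ χ₂ : M → ℝ, LogLip (a + G) χ₁ ∧ LogLip (a + G) χ₂ ∧ ∫ x, χ₁ x ∂μ = 1 ∧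
      ∫ x, χ₂ x ∂μ = 1 ∧ ∀ x, corrector μ ρ f J g k x =
        (G * δ + 1) * (1 - kap) / kap * (χ₁ x - χ₂ x) := by
  have hl0 := hs.lam_nonneg
  have hl1 := hs.lam_lt_one
  have ha := hs.a_nonneg
  have hG := hs.G_nonneg
  have hδ := hs.diam_nonneg
  have hGδ : 0 ≤ G * δ := mul_nonneg hG hδ
  have hE1 : Real.exp (-((a + G) * δ)) ≤ 1 :=
    Real.exp_le_one_iff.2 (by have := mul_nonneg (add_nonneg ha hG) hδ; linarith)
  have hkap0 : 0 < kap := by rw [hkap]; exact mul_pos (by linarith) (Real.exp_pos _)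
  have hkap1 : kap < 1 := by rw [hkap]; nlinarith [Real.exp_pos (-((a + G) * δ))]
  induction k with
  | zero =>
    exact ⟨ρ, ρ, hs.density.mono (by linarith), hs.density.mono (by linarith), hs.density_one,
      hs.density_one, fun x => by simp [corrector]⟩
  | succ k ih =>
    obtain ⟨χ₁, χ₂, h₁, h₂, i₁, i₂, hq⟩ := ih
    -- Since `|ĝ| ≤ G * δ`, this choice gives `ĝ + c ≥ 1`, so that its Lipschitz constant is also a
    -- log-Lipschitz constant.
    set c := G * δ + 1 with hc
    have hc0 : 0 < c := by linarith
    set A := c * (1 - kap) / kap with hA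
    have hA0 : 0 < A := div_pos (mul_pos hc0 (by linarith)) hkap0
    have hAc : (1 - kap) * (A + c) = A := by rw [hA]; field_simp; ring
    set h := pushDensity f J ρ k with hh
    have hh1 : LogLip a h := hs.pushDensity_logLip k
    have hhc := hh1.continuous
    set γ := centered μ ρ f g k with hγ
    have hγc : Continuous γ := hs.centered_continuous k
    have hw : LogLip (a + G) (fun x => (γ x + c) * h x) := by
      rw [add_comm a]
      refine (LogLip.of_one_le (fun x => ?_) fun x y => ?_).mul hh1
      · linarith [(abs_le.1 (hs.abs_centered_le k x)).1]
      · simpa using hs.centered_lipschitz k x y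
    have hwi : ∫ x, (γ x + c) * h x ∂μ = c := by
      simp only [add_mul]
      have hγi : Integrable (fun x => γ x * h x) μ := (hγc.mul hhc).integrable_of_compact
      rw [integral_add hγi (hhc.integrable_of_compact.const_mul c), integral_const_mul,
        hs.pushDensity_integral, hs.centered_integral]
      ring
    set η₁ : M → ℝ := fun x => (A + c)⁻¹ * (A * χ₁ x + (γ x + c) * h x) with hη₁
    set η₂ : M → ℝ := fun x => (A + c)⁻¹ * (A * χ₂ x + c * h x) with hη₂
    have hAcp : 0 < (A + c)⁻¹ := inv_pos.2 (by linarith)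
    have l₁ : LogLip (a + G) η₁ := ((h₁.const_mul hA0).add hw).const_mul hAcp
    have l₂ : LogLip (a + G) η₂ :=
      ((h₂.const_mul hA0).add ((hh1.mono (by linarith)).const_mul hc0)).const_mul hAcp
    have j₁ : ∫ x, η₁ x ∂μ = 1 := by
      rw [hη₁, integral_const_mul, integral_add
        (h₁.continuous.integrable_of_compact.const_mul _) hw.continuous.integrable_of_compact,
        integral_const_mul, i₁, hwi]
      field_simp
    have j₂ : ∫ x, η₂ x ∂μ = 1 := by
      rw [hη₂, integral_const_mul, integral_add
        (h₂.continuous.integrable_of_compact.const_mul _)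
        (hhc.integrable_of_compact.const_mul _),
        integral_const_mul, integral_const_mul, i₂, hs.pushDensity_integral]
      field_simp
    -- This is the purpose of `a_large`: the cone of constant `a + G` is mapped into a strictly
    -- smaller one, with ratio halfway between `lam` and 1.
    have hlam : lam * (a + G + C) ≤ (1 + lam) / 2 * (a + G) := by
      nlinarith [hs.a_large]
    obtain ⟨ξ₁, k₁, m₁, e₁⟩ := (hs.expanding k).transfer_split hs.C_nonneg (add_nonneg ha hG)
      (by linarith) (by linarith) hlam hs.diam hs.measure_pos l₁ j₁
    obtain ⟨ξ₂, k₂, m₂, e₂⟩ := (hs.expanding k).transfer_split hs.C_nonneg (add_nonneg ha hG)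
      (by linarith) (by linarith) hlam hs.diam hs.measure_pos l₂ j₂
    refine ⟨ξ₁, ξ₂, k₁, k₂, m₁, m₂, fun x => ?_⟩
    have hsplit : (fun x => corrector μ ρ f J g k x + γ x * h x) =
        fun x => (A + c) * (η₁ x - η₂ x) := by
      funext x
      rw [hq x, hη₁, hη₂]
      have : A + c ≠ 0 := by linarith
      field_simp
      ring
    have hstep : corrector μ ρ f J g (k + 1) x =
        (A + c) * (transfer (f k) (J k) η₁ x - transfer (f k) (J k) η₂ x) := by
      change transfer (f k) (J k) (fun x => corrector μ ρ f J g k x + γ x * h x) x = _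
      rw [hsplit, (hs.expanding k).transfer_const_mul, (hs.expanding k).transfer_sub]
    rw [hstep, e₁, e₂, ← hkap]
    linear_combination (ξ₁ x - ξ₂ x) * hAc

/-- Divide the representation of `corrector_eq` by the density. Both `χ` and `h` are in a cone and
have integral one, so `χ / h` is at most `K` and has log-Lipschitz constant `b`. The constants enter
through equations in the data of the system only, which makes the bounds uniform in `k` and in the
sequences. -/
theorem condMean_bound {kap : ℝ}
    (hkap : kap = (1 - (1 + lam) / 2) * Real.exp (-((a + G) * δ))) {A b K : ℝ}
    (hA : A = (G * δ + 1) * (1 - kap) / kap) (hb : b = a + G + a)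
    (hK : K = Real.exp ((a + G) * δ) * Real.exp (a * δ)) (k : ℕ) :
    (∀ x, |condMean μ ρ f J g k x| ≤ A * K) ∧ ∀ x y,
      |condMean μ ρ f J g k x - condMean μ ρ f J g k y| ≤
        2 * A * (K * b * Real.exp (b * δ)) * dist x y := by
  obtain ⟨χ₁, χ₂, h₁, h₂, i₁, i₂, hq⟩ := hs.corrector_eq hkap k
  have ha := hs.a_nonneg
  have hG := hs.G_nonneg
  have hδ := hs.diam_nonneg
  have hE1 : Real.exp (-((a + G) * δ)) ≤ 1 :=
    Real.exp_le_one_iff.2 (by have := mul_nonneg (add_nonneg ha hG) hδ; linarith)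
  have hkap0 : 0 < kap := by
    rw [hkap]; exact mul_pos (by linarith [hs.lam_lt_one]) (Real.exp_pos _)
  have hkap1 : kap < 1 := by
    rw [hkap]; nlinarith [Real.exp_pos (-((a + G) * δ)), hs.lam_nonneg, hs.lam_lt_one]
  have hA0 : 0 ≤ A := by
    rw [hA]
    exact div_nonneg (mul_nonneg (by have := mul_nonneg hG hδ; linarith) (by linarith)) hkap0.le
  have hh := hs.pushDensity_logLip k
  have hV := hs.measure_pos
  have bound : ∀ χ : M → ℝ, LogLip (a + G) χ → ∫ x, χ x ∂μ = 1 →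
      ∀ x, χ x / pushDensity f J ρ k x ≤ K := by
    intro χ hχ iχ x
    have b1 := (hχ.bounds (μ := μ) (add_nonneg ha hG) hs.diam x).1
    have b2 := (hh.bounds (μ := μ) ha hs.diam x).2
    rw [iχ, mul_one] at b1
    rw [hs.pushDensity_integral] at b2
    have hp := hh.1 x
    rw [div_le_iff₀ hp, hK]
    refine le_of_mul_le_mul_right ?_ hV
    calc χ x * μ.real Set.univ ≤ Real.exp ((a + G) * δ) * 1 := by linarith
      _ ≤ Real.exp ((a + G) * δ) *
            (Real.exp (a * δ) * pushDensity f J ρ k x * μ.real Set.univ) :=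
          mul_le_mul_of_nonneg_left b2 (Real.exp_pos _).le
      _ = _ := by ring
  have hu : ∀ x, condMean μ ρ f J g k x =
      A * (χ₁ x / pushDensity f J ρ k x - χ₂ x / pushDensity f J ρ k x) := by
    intro x
    rw [condMean, hq x, hA]
    ring
  have r₁ := h₁.div hh
  have r₂ := h₂.div hh
  rw [← hb] at r₁ r₂
  have hb0 : 0 ≤ b := by linarith
  refine ⟨fun x => ?_, fun x y => ?_⟩
  · rw [hu, abs_mul, abs_of_nonneg hA0]
    refine mul_le_mul_of_nonneg_left ?_ hA0
    have := r₁.1 x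
    have := r₂.1 x
    rw [abs_le]
    constructor <;> linarith [bound χ₁ h₁ i₁ x, bound χ₂ h₂ i₂ x]
  · have d₁ := r₁.lipschitz hb0 hs.diam (bound χ₁ h₁ i₁) x y
    have d₂ := r₂.lipschitz hb0 hs.diam (bound χ₂ h₂ i₂) x y
    rw [hu, hu, ← mul_sub, abs_mul, abs_of_nonneg hA0]
    calc A * _ ≤ A * (K * b * Real.exp (b * δ) * dist x y
          + K * b * Real.exp (b * δ) * dist x y) := by
          refine mul_le_mul_of_nonneg_left ?_ hA0
          rw [abs_le] at d₁ d₂ ⊢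
          constructor <;> linarith [d₁.1, d₁.2, d₂.1, d₂.2]
      _ = _ := by ring

theorem condMean_continuous (k : ℕ) : Continuous (condMean μ ρ f J g k) :=
  (LipschitzWith.of_dist_le' fun x y => by
    rw [Real.dist_eq]; exact (hs.condMean_bound rfl rfl rfl rfl k).2 x y).continuous

theorem martDiff_continuous (k : ℕ) : Continuous (martDiff μ ρ f J g k) :=
  ((hs.condMean_continuous k).add (hs.centered_continuous k)).sub
    ((hs.condMean_continuous (k + 1)).comp (hs.expanding k).continuous)

/-- The martingale differences are orthogonal to the functions of the future. -/
theorem martDiff_orthogonal (k : ℕ) {φ : M → ℝ} (hφ : Continuous φ) :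
    ∫ x, φ (f k x) * martDiff μ ρ f J g k x * pushDensity f J ρ k x ∂μ = 0 := by
  have hT := hs.expanding k
  have hu := hs.condMean_continuous k
  have hu' := hs.condMean_continuous (k + 1)
  have hh := hs.pushDensity_continuous k
  have hc := hs.centered_continuous k
  have hq : Continuous fun x =>
      corrector μ ρ f J g k x + centered μ ρ f g k x * pushDensity f J ρ k x := by
    simp only [← hs.condMean_mul]
    exact (hu.mul hh).add (hc.mul hh)
  have e1 := hT.duality φ _ hφ hq
  have e2 := hT.duality (fun y => φ y * condMean μ ρ f J g (k + 1) y) _ (hφ.mul hu') hh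
  have e3 : ∫ x, φ (f k x) * martDiff μ ρ f J g k x * pushDensity f J ρ k x ∂μ =
      ∫ x, φ (f k x) * (corrector μ ρ f J g k x
        + centered μ ρ f g k x * pushDensity f J ρ k x) ∂μ -
      ∫ x, φ (f k x) * condMean μ ρ f J g (k + 1) (f k x) * pushDensity f J ρ k x ∂μ := by
    rw [← integral_sub]
    · congr 1
      funext x
      rw [← hs.condMean_mul, martDiff]
      ring
    · exact ((hφ.comp hT.continuous).mul hq).integrable_of_compact
    · exact (((hφ.comp hT.continuous).mul (hu'.comp hT.continuous)).mul hh).integrable_of_compact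
  rw [e3, e1, e2, sub_eq_zero]
  congr 1
  funext y
  rw [mul_assoc]
  congr 1
  exact (hs.condMean_mul (k + 1) y).symm

/-- The additional function `φ` of the final state makes the induction close: the last summand of
`Ŝ_{n+1}` and `φ` together form a function of the state at time `n`. Then `u_n + ĝ_n + φ ∘ f_n = d_n
+ (u_{n+1} + φ) ∘ f_n`, and the cross term vanishes by `martDiff_orthogonal`. -/
theorem integral_sq_decomposition (n : ℕ) {φ : M → ℝ} (hφ : Continuous φ) :
    ∫ x, (centeredSum μ ρ f g n x + φ (composeFrom f 0 n x)) ^ 2 * ρ x ∂μ =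
      ∫ x, (condMean μ ρ f J g n x + φ x) ^ 2 * pushDensity f J ρ n x ∂μ +
        ∑ k ∈ Finset.range n, ∫ x, martDiff μ ρ f J g k x ^ 2 * pushDensity f J ρ k x ∂μ := by
  induction n generalizing φ with
  | zero => simp [centeredSum, condMean, corrector, composeFrom, pushDensity]
  | succ n ih =>
    have hT := hs.expanding n
    have hh := hs.pushDensity_continuous n
    have hd := hs.martDiff_continuous n
    have hu' := hs.condMean_continuous (n + 1)
    have h1 := ih (φ := fun y => centered μ ρ f g n y + φ (f n y))
      ((hs.centered_continuous n).add (hφ.comp hT.continuous))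
    have lhs : ∀ x, centeredSum μ ρ f g (n + 1) x + φ (composeFrom f 0 (n + 1) x) =
        centeredSum μ ρ f g n x + (centered μ ρ f g n (composeFrom f 0 n x) +
          φ (f n (composeFrom f 0 n x))) := by
      intro x
      simp only [centeredSum, Finset.sum_range_succ, composeFrom, zero_add, Function.comp_apply]
      ring
    have hψ : Continuous fun y => condMean μ ρ f J g (n + 1) y + φ y := hu'.add hφ
    have e1 := hT.duality (fun y => (condMean μ ρ f J g (n + 1) y + φ y) ^ 2) _ (hψ.pow 2) hh
    have e2 := hs.martDiff_orthogonal n hψ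
    simp only [lhs]
    rw [h1, Finset.sum_range_succ]
    have e3 : ∫ x, (condMean μ ρ f J g n x + (centered μ ρ f g n x + φ (f n x))) ^ 2
          * pushDensity f J ρ n x ∂μ =
        ∫ x, martDiff μ ρ f J g n x ^ 2 * pushDensity f J ρ n x ∂μ +
        2 * ∫ x, (condMean μ ρ f J g (n + 1) (f n x) + φ (f n x)) * martDiff μ ρ f J g n x
          * pushDensity f J ρ n x ∂μ +
        ∫ x, (condMean μ ρ f J g (n + 1) (f n x) + φ (f n x)) ^ 2 * pushDensity f J ρ n x ∂μ := by
      have c1 : Integrable (fun x => martDiff μ ρ f J g n x ^ 2 * pushDensity f J ρ n x) μ :=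
        ((hd.pow 2).mul hh).integrable_of_compact
      have c2 : Integrable (fun x => 2 * ((condMean μ ρ f J g (n + 1) (f n x) + φ (f n x))
          * martDiff μ ρ f J g n x * pushDensity f J ρ n x)) μ :=
        (((hψ.comp hT.continuous).mul hd).mul hh).integrable_of_compact.const_mul 2
      have c3 : Integrable (fun x => (condMean μ ρ f J g (n + 1) (f n x) + φ (f n x)) ^ 2
          * pushDensity f J ρ n x) μ :=
        (((hψ.comp hT.continuous).pow 2).mul hh).integrable_of_compact
      rw [← integral_const_mul]
      have e4 := integral_add (c1.add c2) c3
      simp only [Pi.add_apply] at e4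
      rw [← integral_add c1 c2, ← e4]
      congr 1
      funext x
      simp only [martDiff]
      ring
    rw [e3, e2, e1]
    have : transfer (f n) (J n) (pushDensity f J ρ n) = pushDensity f J ρ (n + 1) := rfl
    rw [this]
    ring

theorem sigmaSq_eq (n : ℕ) :
    sigmaSq μ ρ f g n = ∫ x, condMean μ ρ f J g n x ^ 2 * pushDensity f J ρ n x ∂μ +
      ∑ k ∈ Finset.range n, ∫ x, martDiff μ ρ f J g k x ^ 2 * pushDensity f J ρ k x ∂μ := by
  simpa [sigmaSq] using hs.integral_sq_decomposition n (φ := fun _ => 0) continuous_const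

end SequentialSystem

end Sequential

end

noncomputable section

/-! ### Oscillation of Birkhoff sums under specification -/

section Birkhoff

variable {M : Type*}

/-- The sum `∑_{i<n} g_{j+i} ∘ f_{j+i-1} ∘ ⋯ ∘ f_j`. -/
def birkhoff (f : ℕ → M → M) (g : ℕ → M → ℝ) (j n : ℕ) (x : M) : ℝ :=
  ∑ i ∈ Finset.range n, g (j + i) (composeFrom f j i x)

theorem composeFrom_add (f : ℕ → M → M) (j m n : ℕ) (x : M) :
    composeFrom f j (m + n) x = composeFrom f (j + m) n (composeFrom f j m x) := by
  induction n with
  | zero => rfl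
  | succ n ih =>
    rw [← add_assoc]
    simp only [composeFrom, Function.comp_apply, ih, add_assoc]

theorem composeFrom_congr {f f' : ℕ → M → M} {j j' m : ℕ}
    (h : ∀ i < m, f (j + i) = f' (j' + i)) : composeFrom f j m = composeFrom f' j' m := by
  induction m with
  | zero => rfl
  | succ m ih =>
    simp only [composeFrom]
    rw [ih fun i hi => h i (by omega), h m (by omega)]

theorem birkhoff_add (f : ℕ → M → M) (g : ℕ → M → ℝ) (j m n : ℕ) (x : M) :
    birkhoff f g j (m + n) x =
      birkhoff f g j m x + birkhoff f g (j + m) n (composeFrom f j m x) := by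
  simp only [birkhoff, Finset.sum_range_add, ← composeFrom_add, add_assoc]

theorem birkhoff_congr {f f' : ℕ → M → M} {g g' : ℕ → M → ℝ} {j j' n : ℕ}
    (hf : ∀ i < n, f (j + i) = f' (j' + i)) (hg : ∀ i < n, g (j + i) = g' (j' + i)) :
    birkhoff f g j n = birkhoff f' g' j' n := by
  funext x
  refine Finset.sum_congr rfl fun i hi => ?_
  have hi' := Finset.mem_range.1 hi
  rw [hg i hi', composeFrom_congr fun i' hi'' => hf i' (hi''.trans hi')]

theorem birkhoff_periodic_le {f : ℕ → M → M} {g : ℕ → M → ℝ} {n : ℕ} {s : ℝ}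
    (hf : ∀ i, f (i + n) = f i) (hg : ∀ i, g (i + n) = g i)
    (h : ∀ z z', birkhoff f g 0 n z - birkhoff f g 0 n z' ≤ s) (r : ℕ) (z z' : M) :
    birkhoff f g 0 (r * n) z - birkhoff f g 0 (r * n) z' ≤ r * s := by
  induction r with
  | zero => simp [birkhoff]
  | succ r ih =>
    have hf' : Function.Periodic f n := hf
    have hg' : Function.Periodic g n := hg
    have e : birkhoff f g (0 + r * n) n = birkhoff f g 0 n :=
      birkhoff_congr (fun i _ => by rw [zero_add, zero_add, add_comm]; exact hf'.nat_mul r i)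
        (fun i _ => by rw [zero_add, zero_add, add_comm]; exact hg'.nat_mul r i)
    rw [add_mul, one_mul, birkhoff_add, birkhoff_add, e]
    push_cast
    linarith [h (composeFrom f 0 (r * n) z) (composeFrom f 0 (r * n) z')]

/-- Words and specification control the times `1, …, L` of a block, whereas Birkhoff sums start at
time 0; the shift costs only two boundary terms. -/
theorem birkhoff_succ_left (f : ℕ → M → M) (g : ℕ → M → ℝ) (n : ℕ) (x : M) :
    birkhoff f g 0 n x = ∑ t ∈ Finset.range n, g (t + 1) (composeFrom f 0 (t + 1) x)
      + g 0 x - g n (composeFrom f 0 n x) := by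
  have h1 := Finset.sum_range_succ (fun i => g i (composeFrom f 0 i x)) n
  rw [Finset.sum_range_succ'] at h1
  simp only [birkhoff, zero_add]
  simp only [composeFrom, zero_add, id] at h1 ⊢
  linarith

end Birkhoff

section Specification

variable {M : Type*} [MetricSpace M] {N : ℕ} {F : Fin N → M → M} {G : Fin N → M → ℝ}
  {a ε κ : ℝ} {L D : ℕ}

theorem wordSeq_restrict (s : ℕ → Fin N) {k i : ℕ} (hi : i ≤ L) :
    wordSeq (L := L) (fun m => s (k + m)) i = s (k + i) := by
  have : ((Fin.ofNat (L + 1) i : Fin (L + 1)) : ℕ) = i := by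
    simp [Fin.ofNat, Nat.mod_eq_of_lt (Nat.lt_succ_of_le hi)]
  simp only [wordSeq, this]

/-- Under specification, one can follow all the words of a sequence with large sums, or all those
with small sums: the oscillation of the Birkhoff sums grows linearly. -/
theorem HasSpecification.exists_birkhoff_sub (hD : HasSpecification F ε L D)
    (hlip : ∀ j x y, |G j x - G j y| ≤ κ * dist x y) (hκ : 0 ≤ κ) (hκε : κ * ε ≤ a / 4)
    (hgap : ∀ j x y, D * |G j x - G j y| ≤ a * L / 4)
    (hword : ∀ w₁ w₂ : Fin (L + 1) → Fin N, ∃ x y : M, a * L ≤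
      ∑ i ∈ Finset.range L, (G (wordSeq w₂ (i + 1))
          (composeFrom (fun k => F (wordSeq w₁ k)) 0 (i + 1) x) -
        G (wordSeq w₂ (i + 1)) (composeFrom (fun k => F (wordSeq w₁ k)) 0 (i + 1) y)))
    {c : ℝ} (hc : ∀ j x y, |G j x - G j y| ≤ c) (ωf ωg : ℕ → Fin N) :
    ∃ z z' : M, ∀ K : ℕ, K * (a * L / 4) - 2 * c ≤
      birkhoff (fun k => F (ωf k)) (fun k => G (ωg k)) 0 (K * (L + D)) z -
        birkhoff (fun k => F (ωf k)) (fun k => G (ωg k)) 0 (K * (L + D)) z' := by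
  set f := fun k => F (ωf k) with hf
  set P := L + D with hP
  choose X Y hXY using fun k : ℕ => hword (fun m => ωf (k * P + m)) (fun m => ωg (k * P + m))
  have hXY' : ∀ k, a * L ≤ ∑ i ∈ Finset.range L,
      (G (ωg (k * P + (i + 1))) (composeFrom f (k * P) (i + 1) (X k)) -
        G (ωg (k * P + (i + 1))) (composeFrom f (k * P) (i + 1) (Y k))) := by
    intro k
    refine (hXY k).trans_eq (Finset.sum_congr rfl fun i hi => ?_)
    have hi' := Finset.mem_range.1 hi
    rw [wordSeq_restrict ωg (by omega)]
    have : composeFrom (fun k_1 => F (wordSeq (L := L) (fun m => ωf (k * P + m)) k_1)) 0 (i + 1) =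
        composeFrom f (k * P) (i + 1) := by
      refine composeFrom_congr fun i' hi'' => ?_
      rw [zero_add, wordSeq_restrict ωf (by omega)]
    rw [this]
  have hstep : ∀ k, k * P + L + D ≤ (k + 1) * P := fun k => by rw [hP]; ring_nf; rfl
  obtain ⟨z, hz⟩ := hD ωf (fun k => k * P) X hstep
  obtain ⟨z', hz'⟩ := hD ωf (fun k => k * P) Y hstep
  refine ⟨z, z', fun K => ?_⟩
  have main : ∀ K : ℕ, K * (a * L / 4) ≤ ∑ t ∈ Finset.range (K * P),
      (G (ωg (t + 1)) (composeFrom f 0 (t + 1) z) -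
        G (ωg (t + 1)) (composeFrom f 0 (t + 1) z')) := by
    intro K
    induction K with
    | zero => simp
    | succ K ih =>
      -- Each of the two shadowing orbits loses at most `κ * ε ≤ a / 4` per time step.
      have hblock : a * L - L * (a / 2) ≤ ∑ i ∈ Finset.range L,
          (G (ωg (K * P + i + 1)) (composeFrom f 0 (K * P + i + 1) z) -
            G (ωg (K * P + i + 1)) (composeFrom f 0 (K * P + i + 1) z')) := by
        have e1 : a * L - L * (a / 2) ≤ ∑ i ∈ Finset.range L,
            ((G (ωg (K * P + (i + 1))) (composeFrom f (K * P) (i + 1) (X K)) -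
              G (ωg (K * P + (i + 1))) (composeFrom f (K * P) (i + 1) (Y K))) - a / 2) := by
          rw [Finset.sum_sub_distrib, Finset.sum_const, Finset.card_range, nsmul_eq_mul]
          linarith [hXY' K]
        refine e1.trans (Finset.sum_le_sum fun i hi => ?_)
        have hi' := Finset.mem_range.1 hi
        have b1 := hz K i hi'
        have b2 := hz' K i hi'
        have c1 := (hlip (ωg (K * P + i + 1)) _ _).trans
          ((mul_le_mul_of_nonneg_left b1 hκ).trans hκε)
        have c2 := (hlip (ωg (K * P + i + 1)) _ _).trans
          ((mul_le_mul_of_nonneg_left b2 hκ).trans hκε)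
        simp only [← add_assoc] at c1 c2 ⊢
        rw [abs_le] at c1 c2
        linarith [c1.1, c2.2]
      -- Nothing is known about the orbits during the gap, so each of its `D` terms is bounded by
      -- the full oscillation of the observable.
      have hrest : -(a * L / 4) ≤ ∑ i ∈ Finset.range D,
          (G (ωg (K * P + (L + i) + 1)) (composeFrom f 0 (K * P + (L + i) + 1) z) -
            G (ωg (K * P + (L + i) + 1)) (composeFrom f 0 (K * P + (L + i) + 1) z')) := by
        rcases Nat.eq_zero_or_pos D with h0 | h0
        · have := hgap (ωg 0) z z
          rw [h0] at this ⊢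
          simp only [Finset.range_zero, Finset.sum_empty]
          simp at this
          linarith
        · have hD0 : (0 : ℝ) < D := by exact_mod_cast h0
          have : ∑ i ∈ Finset.range D, (-(a * L / 4) / D) = -(a * L / 4) := by
            rw [Finset.sum_const, Finset.card_range, nsmul_eq_mul]
            field_simp
          rw [← this]
          refine Finset.sum_le_sum fun i _ => ?_
          have h1 := hgap (ωg (K * P + (L + i) + 1)) (composeFrom f 0 (K * P + (L + i) + 1) z)
            (composeFrom f 0 (K * P + (L + i) + 1) z')
          rw [div_le_iff₀ hD0]
          nlinarith [neg_abs_le (G (ωg (K * P + (L + i) + 1))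
            (composeFrom f 0 (K * P + (L + i) + 1) z) - G (ωg (K * P + (L + i) + 1))
            (composeFrom f 0 (K * P + (L + i) + 1) z'))]
      rw [add_mul, one_mul, Finset.sum_range_add, hP, Finset.sum_range_add, ← hP]
      push_cast
      linarith
  have hm := main K
  rw [Finset.sum_sub_distrib] at hm
  rw [birkhoff_succ_left, birkhoff_succ_left]
  have h0 := (abs_le.1 (hc (ωg 0) z z')).1
  have h1 := (abs_le.1 (hc (ωg (K * P)) (composeFrom f 0 (K * P) z)
    (composeFrom f 0 (K * P) z'))).2
  linarith

/-- Linear lower bound for the oscillation of the Birkhoff sums along finite words, by passing to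
their periodic continuation. -/
theorem HasSpecification.mul_le_of_birkhoff_sub_le (hD : HasSpecification F ε L D)
    (hlip : ∀ j x y, |G j x - G j y| ≤ κ * dist x y) (hκ : 0 ≤ κ) (hκε : κ * ε ≤ a / 4)
    (hgap : ∀ j x y, D * |G j x - G j y| ≤ a * L / 4)
    (hword : ∀ w₁ w₂ : Fin (L + 1) → Fin N, ∃ x y : M, a * L ≤
      ∑ i ∈ Finset.range L, (G (wordSeq w₂ (i + 1))
          (composeFrom (fun k => F (wordSeq w₁ k)) 0 (i + 1) x) -
        G (wordSeq w₂ (i + 1)) (composeFrom (fun k => F (wordSeq w₁ k)) 0 (i + 1) y)))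
    {c : ℝ} (hc : ∀ j x y, |G j x - G j y| ≤ c) (ωf ωg : ℕ → Fin N) (n : ℕ) {s : ℝ}
    (hs : ∀ z z', birkhoff (fun k => F (ωf k)) (fun k => G (ωg k)) 0 n z -
      birkhoff (fun k => F (ωf k)) (fun k => G (ωg k)) 0 n z' ≤ s) :
    n * (a * L / 4) ≤ (L + D) * s := by
  obtain ⟨z, z', hzz⟩ := hD.exists_birkhoff_sub hlip hκ hκε hgap hword hc
    (fun i => ωf (i % n)) (fun i => ωg (i % n))
  have hper : ∀ z z', birkhoff (fun k => F (ωf (k % n))) (fun k => G (ωg (k % n))) 0 n z -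
      birkhoff (fun k => F (ωf (k % n))) (fun k => G (ωg (k % n))) 0 n z' ≤ s := by
    have : birkhoff (fun k => F (ωf (k % n))) (fun k => G (ωg (k % n))) 0 n =
        birkhoff (fun k => F (ωf k)) (fun k => G (ωg k)) 0 n :=
      birkhoff_congr (fun i hi => by simp [Nat.mod_eq_of_lt hi])
        (fun i hi => by simp [Nat.mod_eq_of_lt hi])
    rw [this]
    exact hs
  -- The time `r * n * (L + D)` consists both of `r * n` specification blocks and of `r * (L + D)`
  -- periods of the word. Letting `r` grow removes the boundary error `2 * c`, so the final bound
  -- has no additive constant and is useful even for `n = 1`.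
  have key : ∀ r : ℕ, r * (n * (a * L / 4) - (L + D) * s) ≤ 2 * c := by
    intro r
    have h1 := hzz (r * n)
    have h2 := birkhoff_periodic_le (fun i => by simp) (fun i => by simp) hper (r * (L + D)) z z'
    rw [show r * (L + D) * n = r * n * (L + D) by ring] at h2
    push_cast at h1 h2
    linarith
  by_contra hlt
  obtain ⟨r, hr⟩ := exists_nat_gt (2 * c / (n * (a * L / 4) - (L + D) * s))
  rw [div_lt_iff₀ (by linarith)] at hr
  linarith [key r]

end Specification

end

noncomputable section

/-! ### Linear growth of the variance -/

section Variance

variable {M : Type*} [MetricSpace M] [CompactSpace M] [MeasurableSpace M] [BorelSpace M]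
  {μ : Measure M} [IsFiniteMeasure μ]

/-- Finitely many balls of radius `r / 2` cover the space, and every ball of radius `r` contains one
of them. -/
theorem exists_pos_le_measureReal_ball [Nonempty M] [μ.IsOpenPosMeasure] {r : ℝ} (hr : 0 < r) :
    ∃ m : ℝ, 0 < m ∧ ∀ p : M, m ≤ μ.real (Metric.ball p r) := by
  obtain ⟨t, -, htf, ht⟩ := finite_cover_balls_of_compact
    (isCompact_univ (X := M)) (half_pos hr)
  have hne : t.Nonempty := by
    obtain ⟨p⟩ := ‹Nonempty M›
    obtain ⟨x, hx, -⟩ := Set.mem_iUnion₂.1 (ht (Set.mem_univ p))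
    exact ⟨x, hx⟩
  obtain ⟨x₀, -, hx₀⟩ := Set.exists_min_image t (fun x => μ.real (Metric.ball x (r / 2))) htf hne
  refine ⟨μ.real (Metric.ball x₀ (r / 2)), ?_, fun p => ?_⟩
  · exact ENNReal.toReal_pos (Metric.isOpen_ball.measure_pos μ
      ⟨x₀, Metric.mem_ball_self (half_pos hr)⟩).ne' (measure_ne_top _ _)
  · obtain ⟨x, hx, hpx⟩ := Set.mem_iUnion₂.1 (ht (Set.mem_univ p))
    refine (hx₀ x hx).trans (measureReal_mono fun y hy => ?_)
    rw [Metric.mem_ball] at hy hpx ⊢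
    calc dist y p ≤ dist y x + dist p x := dist_triangle_right _ _ _
      _ < r := by linarith

/-- A function which oscillates and is controlled at a fixed scale has a large second moment. -/
theorem le_integral_sq_mul {r η m₀ m₁ : ℝ} (hη : 0 < η) (hm₁ : 0 ≤ m₁)
    (hball : ∀ p : M, m₀ ≤ μ.real (Metric.ball p r)) {φ h : M → ℝ} (hφ : Continuous φ)
    (hh : Continuous h) (hhm : ∀ x, m₁ ≤ h x)
    (hmod : ∀ x y, dist x y < r → |φ x - φ y| ≤ η) {z z' : M} (hz : 4 * η < φ z - φ z') :
    η ^ 2 * m₁ * m₀ ≤ ∫ x, φ x ^ 2 * h x ∂μ := by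
  -- Otherwise all oscillations would stay below `4 * η`. By the modulus of continuity, `|φ| ≥ η`
  -- then holds on the whole ball around `p`.
  obtain ⟨p, hp⟩ : ∃ p, 2 * η ≤ |φ p| := by
    by_contra! hcon
    have h1 := abs_lt.1 (hcon z)
    have h2 := abs_lt.1 (hcon z')
    linarith [h1.2, h2.1]
  have hlow : ∀ x ∈ Metric.ball p r, η ^ 2 * m₁ ≤ φ x ^ 2 * h x := by
    intro x hx
    have h1 := hmod p x (by rw [dist_comm]; exact hx)
    have h2 : η ≤ |φ x| := by
      have := abs_sub_abs_le_abs_sub (φ p) (φ x)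
      linarith
    have h3 : η ^ 2 ≤ φ x ^ 2 := by rw [← sq_abs (φ x)]; gcongr
    exact mul_le_mul h3 (hhm x) hm₁ (sq_nonneg _)
  have hi : Integrable (fun x => φ x ^ 2 * h x) μ := ((hφ.pow 2).mul hh).integrable_of_compact
  calc η ^ 2 * m₁ * m₀ ≤ η ^ 2 * m₁ * μ.real (Metric.ball p r) :=
        mul_le_mul_of_nonneg_left (hball p) (by positivity)
    _ = ∫ _ in Metric.ball p r, η ^ 2 * m₁ ∂μ := by
        rw [setIntegral_const, smul_eq_mul, mul_comm]
    _ ≤ ∫ x in Metric.ball p r, φ x ^ 2 * h x ∂μ :=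
        setIntegral_mono_on (integrable_const _).integrableOn hi.integrableOn
          measurableSet_ball hlow
    _ ≤ ∫ x, φ x ^ 2 * h x ∂μ := setIntegral_le_integral hi
        (Filter.Eventually.of_forall fun x => mul_nonneg (sq_nonneg _) (hm₁.trans (hhm x)))

/-- Linear oscillation of all Birkhoff sums, including those of shifted sequences, forces at least
one strongly oscillating `d_k` in every window of a fixed length; each such window contributes `β`
to the exact variance formula. -/
theorem exists_pos_mul_le_sigmaSq [Nonempty M] [μ.IsOpenPosMeasure] {ι : Type*}
    {F : ι → M → M} {J : ι → M → ℝ} {G : ι → M → ℝ} {ρ : M → ℝ} {lam C a Gc δ : ℝ}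
    (hsys : ∀ ωf ωg : ℕ → ι, SequentialSystem μ ρ (fun k => F (ωf k)) (fun k => J (ωf k))
      (fun k => G (ωg k)) lam C a Gc δ)
    (hequi : ∀ r > 0, ∃ r' > 0, ∀ j x y, dist x y < r' → dist (F j x) (F j y) < r)
    {c₀ : ℝ} (hc₀ : 0 < c₀)
    (hosc : ∀ (ωf ωg : ℕ → ι) (n : ℕ) (s : ℝ),
      (∀ z z', birkhoff (fun k => F (ωf k)) (fun k => G (ωg k)) 0 n z -
        birkhoff (fun k => F (ωf k)) (fun k => G (ωg k)) 0 n z' ≤ s) → c₀ * n ≤ s) :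
    ∃ B : ℝ, 0 < B ∧ ∀ (ωf ωg : ℕ → ι) (n : ℕ),
      B * n ≤ sigmaSq μ ρ (fun k => F (ωf k)) (fun k => G (ωg k)) n := by
  rcases isEmpty_or_nonempty ι with hι | hι
  · exact ⟨1, one_pos, fun ωf => (IsEmpty.false (ωf 0)).elim⟩
  have hs0 := hsys (fun _ => Classical.arbitrary ι) (fun _ => Classical.arbitrary ι)
  have hV := hs0.measure_pos
  have ha := hs0.a_nonneg
  have hGc := hs0.G_nonneg
  obtain ⟨U, Q, hUQ⟩ : ∃ U Q : ℝ, ∀ (ωf ωg : ℕ → ι) (k : ℕ),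
      (∀ x, |condMean μ ρ (fun k => F (ωf k)) (fun k => J (ωf k)) (fun k => G (ωg k)) k x| ≤ U) ∧
      ∀ x y, |condMean μ ρ (fun k => F (ωf k)) (fun k => J (ωf k)) (fun k => G (ωg k)) k x -
        condMean μ ρ (fun k => F (ωf k)) (fun k => J (ωf k)) (fun k => G (ωg k)) k y| ≤
          Q * dist x y :=
    ⟨_, _, fun ωf ωg k => (hsys ωf ωg).condMean_bound rfl rfl rfl rfl k⟩
  have hU0 : 0 ≤ U := (abs_nonneg _).trans
    ((hUQ (fun _ => Classical.arbitrary ι) (fun _ => Classical.arbitrary ι) 0).1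
      (Classical.arbitrary M))
  -- Differences oscillating by at most `4 * η = c₀ / 4` account for only a quarter of the
  -- oscillation `c₀` per step, leaving room for the boundary terms.
  set η := c₀ / 16 with hη
  have hη0 : 0 < η := by positivity
  -- `W` dominates the Lipschitz constants of `u_k` and `ĝ_k` together. The radius `r` is such that
  -- points at distance less than `r`, and also their images, are closer than `η / (2 * W)`; hence
  -- `d_k` varies by at most `η` at scale `r`. No Lipschitz constant of the maps is needed.
  set W := |Q| + Gc + 1 with hW
  have hW0 : 0 < W := by positivity
  have hr₀ : 0 < η / (2 * W) := by positivity
  obtain ⟨r', hr'0, hr'⟩ := hequi _ hr₀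
  set r := min (η / (2 * W)) r' with hr
  have hr0 : 0 < r := lt_min hr₀ hr'0
  obtain ⟨m₀, hm₀, hball⟩ := exists_pos_le_measureReal_ball (μ := μ) hr0
  set m₁ := Real.exp (-(a * δ)) / μ.real Set.univ with hm₁
  have hm₁0 : 0 < m₁ := div_pos (Real.exp_pos _) hV
  set β := η ^ 2 * m₁ * m₀ with hβ
  have hβ0 : 0 < β := by positivity
  have hsmall : ∀ t : ℝ, 0 ≤ t → t < η / (2 * W) → W * t ≤ η / 2 := by
    intro t _ ht
    rw [lt_div_iff₀ (by positivity)] at ht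
    linarith
  have hQle : ∀ t : ℝ, 0 ≤ t → Q * t ≤ |Q| * t := fun t ht =>
    mul_le_mul_of_nonneg_right (le_abs_self Q) ht
  -- the second moments of the oscillating terms are bounded below
  have hlow : ∀ (ωf : ℕ → ι) (k : ℕ) (x : M),
      m₁ ≤ pushDensity (fun k => F (ωf k)) (fun k => J (ωf k)) ρ k x := by
    intro ωf k x
    have hs := hsys ωf ωf
    have h1 := ((hs.pushDensity_logLip k).bounds (μ := μ) ha hs.diam x).2
    rw [hs.pushDensity_integral] at h1
    rw [hm₁, div_le_iff₀ hV]
    calc Real.exp (-(a * δ)) = Real.exp (-(a * δ)) * 1 := by ring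
      _ ≤ Real.exp (-(a * δ)) * (Real.exp (a * δ) *
          pushDensity (fun k => F (ωf k)) (fun k => J (ωf k)) ρ k x * μ.real Set.univ) :=
          mul_le_mul_of_nonneg_left h1 (Real.exp_pos _).le
      _ = (Real.exp (-(a * δ)) * Real.exp (a * δ)) *
          (pushDensity (fun k => F (ωf k)) (fun k => J (ωf k)) ρ k x * μ.real Set.univ) := by ring
      _ = _ := by rw [← Real.exp_add]; simp
  have hmean : ∀ (ωf ωg : ℕ → ι) (k : ℕ) (z z' : M),
      4 * η < condMean μ ρ (fun k => F (ωf k)) (fun k => J (ωf k)) (fun k => G (ωg k)) k z -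
        condMean μ ρ (fun k => F (ωf k)) (fun k => J (ωf k)) (fun k => G (ωg k)) k z' →
      β ≤ ∫ x, condMean μ ρ (fun k => F (ωf k)) (fun k => J (ωf k)) (fun k => G (ωg k)) k x ^ 2 *
        pushDensity (fun k => F (ωf k)) (fun k => J (ωf k)) ρ k x ∂μ := by
    intro ωf ωg k z z' hz
    have hs := hsys ωf ωg
    refine le_integral_sq_mul hη0 hm₁0.le hball (hs.condMean_continuous k)
      (hs.pushDensity_continuous k) (hlow ωf k) (fun x y hxy => ?_) hz
    have h1 := hsmall _ dist_nonneg (hxy.trans_le (min_le_left _ _))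
    have h2 := (hUQ ωf ωg k).2 x y
    have h3 := hQle (dist x y) dist_nonneg
    have h4 : 0 ≤ dist x y := dist_nonneg
    nlinarith
  have hdiff : ∀ (ωf ωg : ℕ → ι) (k : ℕ) (z z' : M),
      4 * η < martDiff μ ρ (fun k => F (ωf k)) (fun k => J (ωf k)) (fun k => G (ωg k)) k z -
        martDiff μ ρ (fun k => F (ωf k)) (fun k => J (ωf k)) (fun k => G (ωg k)) k z' →
      β ≤ ∫ x, martDiff μ ρ (fun k => F (ωf k)) (fun k => J (ωf k)) (fun k => G (ωg k)) k x ^ 2 *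
        pushDensity (fun k => F (ωf k)) (fun k => J (ωf k)) ρ k x ∂μ := by
    intro ωf ωg k z z' hz
    have hs := hsys ωf ωg
    refine le_integral_sq_mul hη0 hm₁0.le hball (hs.martDiff_continuous k)
      (hs.pushDensity_continuous k) (hlow ωf k) (fun x y hxy => ?_) hz
    have h1 := hsmall _ dist_nonneg (hxy.trans_le (min_le_left _ _))
    have h2 := hsmall _ dist_nonneg (hr' (ωf k) x y (hxy.trans_le (min_le_right _ _)))
    have h3 := abs_le.1 (((hUQ ωf ωg k).2 x y).trans (hQle _ dist_nonneg))
    have h4 := abs_le.1 (((hUQ ωf ωg (k + 1)).2 (F (ωf k) x) (F (ωf k) y)).trans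
      (hQle _ dist_nonneg))
    have h5 := abs_le.1 (hs.centered_lipschitz k x y)
    have h6 : (0 : ℝ) ≤ dist x y := dist_nonneg
    have h7 : (0 : ℝ) ≤ dist (F (ωf k) x) (F (ωf k) y) := dist_nonneg
    have h8 : |Q| * dist x y + Gc * dist x y ≤ η / 2 := by nlinarith
    have h9 : |Q| * dist (F (ωf k) x) (F (ωf k) y) ≤ η / 2 := by nlinarith
    rw [abs_le]
    simp only [martDiff]
    constructor <;> linarith [h3.1, h3.2, h4.1, h4.2, h5.1, h5.2]
  have hnn : ∀ (ωf : ℕ → ι) (k : ℕ) (φ : M → ℝ), 0 ≤ ∫ x, φ x ^ 2 *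
      pushDensity (fun k => F (ωf k)) (fun k => J (ωf k)) ρ k x ∂μ := fun ωf k φ =>
    integral_nonneg fun x => mul_nonneg (sq_nonneg _) (hm₁0.le.trans (hlow ωf k x))
  -- the Birkhoff sums in terms of the martingale differences
  have hrepr : ∀ (ωf ωg : ℕ → ι) (j n : ℕ) (z z' : M),
      birkhoff (fun k => F (ωf (j + k))) (fun k => G (ωg (j + k))) 0 n z -
        birkhoff (fun k => F (ωf (j + k))) (fun k => G (ωg (j + k))) 0 n z' =
      ∑ i ∈ Finset.range n, (martDiff μ ρ (fun k => F (ωf k)) (fun k => J (ωf k))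
          (fun k => G (ωg k)) (j + i) (composeFrom (fun k => F (ωf k)) j i z) -
        martDiff μ ρ (fun k => F (ωf k)) (fun k => J (ωf k))
          (fun k => G (ωg k)) (j + i) (composeFrom (fun k => F (ωf k)) j i z')) -
      (condMean μ ρ (fun k => F (ωf k)) (fun k => J (ωf k)) (fun k => G (ωg k)) j z -
        condMean μ ρ (fun k => F (ωf k)) (fun k => J (ωf k)) (fun k => G (ωg k)) j z') +
      (condMean μ ρ (fun k => F (ωf k)) (fun k => J (ωf k)) (fun k => G (ωg k)) (j + n)
          (composeFrom (fun k => F (ωf k)) j n z) -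
        condMean μ ρ (fun k => F (ωf k)) (fun k => J (ωf k)) (fun k => G (ωg k)) (j + n)
          (composeFrom (fun k => F (ωf k)) j n z')) := by
    intro ωf ωg j n z z'
    have e : birkhoff (fun k => F (ωf (j + k))) (fun k => G (ωg (j + k))) 0 n =
        birkhoff (fun k => F (ωf k)) (fun k => G (ωg k)) j n :=
      birkhoff_congr (fun i _ => by simp) (fun i _ => by simp)
    rw [e, Finset.sum_sub_distrib, sum_martDiff, sum_martDiff]
    simp only [birkhoff, centered, Finset.sum_sub_distrib]
    ring
  -- With this window length the boundary contribution `4 * U` is below `c₀ * m / 2`.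
  obtain ⟨m, hm⟩ := exists_nat_gt (8 * U / c₀)
  rw [div_lt_iff₀ hc₀] at hm
  have hmpos : 0 < m := by
    rcases Nat.eq_zero_or_pos m with h | h
    · rw [h] at hm; simp at hm; linarith
    · exact h
  have hmR : (0 : ℝ) < m := by exact_mod_cast hmpos
  have hwindow : ∀ (ωf ωg : ℕ → ι) (j : ℕ), β ≤ ∑ i ∈ Finset.range m,
      ∫ x, martDiff μ ρ (fun k => F (ωf k)) (fun k => J (ωf k)) (fun k => G (ωg k)) (j + i) x ^ 2 *
        pushDensity (fun k => F (ωf k)) (fun k => J (ωf k)) ρ (j + i) x ∂μ := by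
    intro ωf ωg j
    by_contra! hlt
    have hle : ∀ i ∈ Finset.range m, ∀ z z' : M,
        martDiff μ ρ (fun k => F (ωf k)) (fun k => J (ωf k)) (fun k => G (ωg k)) (j + i) z -
          martDiff μ ρ (fun k => F (ωf k)) (fun k => J (ωf k)) (fun k => G (ωg k)) (j + i) z' ≤
          4 * η := by
      intro i hi z z'
      by_contra! hcon
      refine absurd (hdiff ωf ωg (j + i) z z' hcon) (not_le.2 (lt_of_le_of_lt ?_ hlt))
      exact Finset.single_le_sum (f := fun i => ∫ x, martDiff μ ρ (fun k => F (ωf k))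
        (fun k => J (ωf k)) (fun k => G (ωg k)) (j + i) x ^ 2 *
        pushDensity (fun k => F (ωf k)) (fun k => J (ωf k)) ρ (j + i) x ∂μ)
        (fun i _ => hnn ωf (j + i) _) hi
    -- The oscillation bound is applied to the shifted sequences, which see the window as starting
    -- at time 0.
    have := hosc (fun k => ωf (j + k)) (fun k => ωg (j + k)) m (m * (4 * η) + 4 * U)
      fun z z' => by
        rw [hrepr]
        have h1 := Finset.sum_le_sum fun i hi => hle i hi
          (composeFrom (fun k => F (ωf k)) j i z) (composeFrom (fun k => F (ωf k)) j i z')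
        rw [Finset.sum_const, Finset.card_range, nsmul_eq_mul] at h1
        have h2 := abs_le.1 ((hUQ ωf ωg j).1 z)
        have h3 := abs_le.1 ((hUQ ωf ωg j).1 z')
        have h4 := abs_le.1 ((hUQ ωf ωg (j + m)).1 (composeFrom (fun k => F (ωf k)) j m z))
        have h5 := abs_le.1 ((hUQ ωf ωg (j + m)).1 (composeFrom (fun k => F (ωf k)) j m z'))
        linarith [h2.1, h3.2, h4.2, h5.1]
    have hcm := mul_pos hc₀ hmR
    rw [hη] at this
    nlinarith
  -- For short times the boundary terms cannot be absorbed by length. Instead `u_0 = 0`, and the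
  -- other boundary term `u_n` is itself part of the variance formula, so its oscillation may be
  -- assumed small too.
  have hfirst : ∀ (ωf ωg : ℕ → ι) (n : ℕ), 1 ≤ n →
      β ≤ sigmaSq μ ρ (fun k => F (ωf k)) (fun k => G (ωg k)) n := by
    intro ωf ωg n hn
    rw [(hsys ωf ωg).sigmaSq_eq]
    by_contra! hlt
    have hsum := Finset.sum_nonneg fun i (_ : i ∈ Finset.range n) => hnn ωf i
      (martDiff μ ρ (fun k => F (ωf k)) (fun k => J (ωf k)) (fun k => G (ωg k)) i)
    have hlast := hnn ωf n
      (condMean μ ρ (fun k => F (ωf k)) (fun k => J (ωf k)) (fun k => G (ωg k)) n)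
    have hle : ∀ i ∈ Finset.range n, ∀ z z' : M,
        martDiff μ ρ (fun k => F (ωf k)) (fun k => J (ωf k)) (fun k => G (ωg k)) (0 + i) z -
          martDiff μ ρ (fun k => F (ωf k)) (fun k => J (ωf k)) (fun k => G (ωg k)) (0 + i) z' ≤
          4 * η := by
      intro i hi z z'
      by_contra! hcon
      rw [zero_add] at hcon
      have h1 := hdiff ωf ωg i z z' hcon
      have h2 := Finset.single_le_sum (f := fun i => ∫ x, martDiff μ ρ (fun k => F (ωf k))
        (fun k => J (ωf k)) (fun k => G (ωg k)) i x ^ 2 *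
        pushDensity (fun k => F (ωf k)) (fun k => J (ωf k)) ρ i x ∂μ)
        (fun i _ => hnn ωf i _) hi
      linarith
    have hle' : ∀ z z' : M,
        condMean μ ρ (fun k => F (ωf k)) (fun k => J (ωf k)) (fun k => G (ωg k)) (0 + n) z -
        condMean μ ρ (fun k => F (ωf k)) (fun k => J (ωf k)) (fun k => G (ωg k)) (0 + n) z' ≤
          4 * η := by
      intro z z'
      by_contra! hcon
      rw [zero_add] at hcon
      have h1 := hmean ωf ωg n z z' hcon
      linarith
    have := hosc (fun k => ωf (0 + k)) (fun k => ωg (0 + k)) n (n * (4 * η) + 4 * η)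
      fun z z' => by
        rw [hrepr]
        have h1 := Finset.sum_le_sum fun i hi => hle i hi
          (composeFrom (fun k => F (ωf k)) 0 i z) (composeFrom (fun k => F (ωf k)) 0 i z')
        rw [Finset.sum_const, Finset.card_range, nsmul_eq_mul] at h1
        have h2 := hle' (composeFrom (fun k => F (ωf k)) 0 n z)
          (composeFrom (fun k => F (ωf k)) 0 n z')
        have h3 : ∀ x, condMean μ ρ (fun k => F (ωf k)) (fun k => J (ωf k))
            (fun k => G (ωg k)) 0 x = 0 := fun x => by simp [condMean, corrector]
        rw [h3, h3]
        linarith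
    have hnR : (1 : ℝ) ≤ n := by exact_mod_cast hn
    rw [hη] at this
    nlinarith
  have hblocks : ∀ (ωf ωg : ℕ → ι) (b : ℕ), b * β ≤ ∑ k ∈ Finset.range (b * m),
      ∫ x, martDiff μ ρ (fun k => F (ωf k)) (fun k => J (ωf k)) (fun k => G (ωg k)) k x ^ 2 *
        pushDensity (fun k => F (ωf k)) (fun k => J (ωf k)) ρ k x ∂μ := by
    intro ωf ωg b
    induction b with
    | zero => simp
    | succ b ih =>
      rw [add_mul, one_mul, Finset.sum_range_add]
      push_cast
      linarith [hwindow ωf ωg (b * m)]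
  -- Below `2 * m` the single bound `β` suffices; from `2 * m` on, at least `n / (2 * m)` full
  -- windows fit.
  refine ⟨β / (2 * m), by positivity, fun ωf ωg n => ?_⟩
  rcases Nat.eq_zero_or_pos n with hn | hn
  · rw [hn, (hsys ωf ωg).sigmaSq_eq]
    simpa using hnn ωf 0 _
  rcases lt_or_ge n (2 * m) with hnm | hnm
  · refine le_trans ?_ (hfirst ωf ωg n hn)
    rw [div_mul_eq_mul_div, div_le_iff₀ (by positivity)]
    have : (n : ℝ) ≤ 2 * m := by exact_mod_cast hnm.le
    exact mul_le_mul_of_nonneg_left this hβ0.le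
  · rw [(hsys ωf ωg).sigmaSq_eq]
    have h1 := hblocks ωf ωg (n / m)
    have h2 := Finset.sum_le_sum_of_subset_of_nonneg
      (f := fun k => ∫ x, martDiff μ ρ (fun k => F (ωf k)) (fun k => J (ωf k))
        (fun k => G (ωg k)) k x ^ 2 *
        pushDensity (fun k => F (ωf k)) (fun k => J (ωf k)) ρ k x ∂μ)
      (Finset.range_subset_range.2 (Nat.div_mul_le_self n m)) (fun i _ _ => hnn ωf i _)
    have h3 := hnn ωf n
      (condMean μ ρ (fun k => F (ωf k)) (fun k => J (ωf k)) (fun k => G (ωg k)) n)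
    have h4 : β / (2 * m) * n ≤ (n / m : ℕ) * β := by
      rw [div_mul_eq_mul_div, div_le_iff₀ (by positivity)]
      have h5 : n < (n / m + 1) * m := by
        have := Nat.div_add_mod n m
        have := Nat.mod_lt n hmpos
        rw [add_mul, one_mul, mul_comm (n / m)]
        omega
      have h6 : 2 ≤ n / m := (Nat.le_div_iff_mul_le hmpos).2 hnm
      have h7 : n ≤ 2 * (n / m) * m := by nlinarith
      have h8 : (n : ℝ) ≤ 2 * (n / m : ℕ) * m := by exact_mod_cast h7
      nlinarith
    linarith

end Variance

end

noncomputable section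

/-! ### Lengths of paths and Lipschitz bounds -/

section Riemannian

open Manifold

variable {d : ℕ} {M : Type*} [MetricSpace M]
  [ChartedSpace (EuclideanSpace ℝ (Fin d)) M]
  [RiemannianBundle (fun x : M => TangentSpace (𝓡 d) x)]
  [IsRiemannianManifold (𝓡 d) M]

theorem exists_path_of_dist_lt [IsManifold (𝓡 d) ∞ M] {x y : M} {r : ℝ} (h : dist x y < r) :
    ∃ γ : ℝ → M, γ 0 = x ∧ γ 1 = y ∧ ContMDiff 𝓘(ℝ, ℝ) (𝓡 d) 1 γ ∧
      pathELength (𝓡 d) γ 0 1 < ENNReal.ofReal r := by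
  have h1 : riemannianEDist (𝓡 d) x y < ENNReal.ofReal r := by
    rw [← IsRiemannianManifold.out (I := 𝓡 d) x y, edist_dist]
    exact (ENNReal.ofReal_lt_ofReal_iff (dist_nonneg.trans_lt h)).2 h
  obtain ⟨γ, h0, h1, hγ, hl, -⟩ :=
    exists_lt_locally_constant_of_riemannianEDist_lt h1 (zero_lt_one (α := ℝ))
  exact ⟨γ, h0, h1, hγ, hl⟩

/-- The function stretches lengths of paths by at most `K`. Since the distance is an infimum of
lengths, the bound is obtained for every `r > dist x y` and then passes to the limit. -/
theorem abs_sub_le_of_norm_mfderiv_le [IsManifold (𝓡 d) ∞ M] {g : M → ℝ}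
    (hg : ContMDiff (𝓡 d) 𝓘(ℝ, ℝ) 1 g) {K : ℝ} (hK : ∀ x, ‖mfderiv (𝓡 d) 𝓘(ℝ, ℝ) g x‖ ≤ K)
    (x y : M) : |g x - g y| ≤ K * dist x y := by
  have hK0 : 0 ≤ K := (ContinuousLinearMap.opNorm_nonneg _).trans (hK x)
  have key : ∀ r, dist x y < r → |g x - g y| ≤ K * r := by
    intro r hr
    have hr0 : 0 ≤ r := dist_nonneg.trans hr.le
    obtain ⟨γ, h0, h1, hγ, hl⟩ := exists_path_of_dist_lt (d := d) hr
    have h2 : riemannianEDist 𝓘(ℝ, ℝ) (g x) (g y) ≤ pathELength 𝓘(ℝ, ℝ) (g ∘ γ) 0 1 :=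
      riemannianEDist_le_pathELength (hg.comp hγ).contMDiffOn (by simp [h0]) (by simp [h1])
        zero_le_one
    have h3 : pathELength 𝓘(ℝ, ℝ) (g ∘ γ) 0 1 ≤
        ENNReal.ofReal K * pathELength (𝓡 d) γ 0 1 := by
      rw [pathELength, pathELength, ← lintegral_const_mul' _ _ ENNReal.ofReal_ne_top]
      refine lintegral_mono fun t => ?_
      rw [mfderiv_comp t (hg.mdifferentiable one_ne_zero _) (hγ.mdifferentiable one_ne_zero t)]
      have := (mfderiv (𝓡 d) 𝓘(ℝ, ℝ) g (γ t)).le_opNorm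
        (mfderiv 𝓘(ℝ, ℝ) (𝓡 d) γ t (1 : ℝ))
      have h5 := this.trans (mul_le_mul_of_nonneg_right (hK (γ t)) (norm_nonneg _))
      rw [← ofReal_norm, ← ofReal_norm, ← ENNReal.ofReal_mul hK0]
      exact ENNReal.ofReal_le_ofReal h5
    rw [← IsRiemannianManifold.out, edist_dist, Real.dist_eq] at h2
    have h6 := h2.trans (h3.trans (mul_le_mul_right hl.le _))
    rw [← ENNReal.ofReal_mul hK0] at h6
    exact (ENNReal.ofReal_le_ofReal_iff (by positivity)).1 h6
  have hlim : Filter.Tendsto (fun r => K * r) (nhdsWithin (dist x y) (Set.Ioi (dist x y)))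
      (nhds (K * dist x y)) :=
    ((continuous_const.mul continuous_id).tendsto _).mono_left nhdsWithin_le_nhds
  exact ge_of_tendsto hlim (Filter.eventually_of_mem self_mem_nhdsWithin fun r hr => key r hr)

end Riemannian

end

noncomputable section

/-! ### Local inverses of immersions between manifolds of the same dimension -/

section LocalInverse

variable {d : ℕ} {M : Type*} [TopologicalSpace M]
  [ChartedSpace (EuclideanSpace ℝ (Fin d)) M] [IsManifold (𝓡 d) ∞ M]

/-- The inverse function theorem is applied to `F` read in the preferred charts at `x` and `F x`,
where the coordinate derivative at the centre is `mfderiv` itself; injectivity suffices as the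
dimensions agree. -/
theorem exists_local_inverse {F : M → M} {x : M} (hF : ContMDiff (𝓡 d) (𝓡 d) 1 F)
    (hinj : ∀ v : TangentSpace (𝓡 d) x, mfderiv (𝓡 d) (𝓡 d) F x v = 0 → v = 0) :
    ∃ e : OpenPartialHomeomorph M M, x ∈ e.source ∧ Set.EqOn F e e.source ∧
      ContMDiffAt (𝓡 d) (𝓡 d) 1 e.symm (F x) := by
  set c := chartAt (EuclideanSpace ℝ (Fin d)) x with hc
  set c' := chartAt (EuclideanSpace ℝ (Fin d)) (F x) with hc'
  set Fh : EuclideanSpace ℝ (Fin d) → EuclideanSpace ℝ (Fin d) := c' ∘ F ∘ c.symm with hFh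
  have h1 : ContDiffAt ℝ 1 Fh (c x) := by
    have := (contMDiffAt_iff.1 (hF x)).2
    simpa [extChartAt, hFh, hc, hc', contDiffWithinAt_univ, Function.comp_def] using this
  set A : EuclideanSpace ℝ (Fin d) →L[ℝ] EuclideanSpace ℝ (Fin d) :=
    mfderiv (𝓡 d) (𝓡 d) F x with hA
  have h2 : HasFDerivAt Fh A (c x) := by
    have := (hF.mdifferentiable one_ne_zero x).hasMFDerivAt.2
    simp only [writtenInExtChartAt, extChartAt, mfld_simps] at this
    exact hasFDerivWithinAt_univ.1 this
  have hAinj : Function.Injective (A : EuclideanSpace ℝ (Fin d) →ₗ[ℝ] EuclideanSpace ℝ (Fin d)) :=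
    (injective_iff_map_eq_zero _).2 hinj
  set A' : EuclideanSpace ℝ (Fin d) ≃L[ℝ] EuclideanSpace ℝ (Fin d) :=
    (LinearEquiv.ofInjectiveEndo _ hAinj).toContinuousLinearEquiv with hA'
  have h3 : HasFDerivAt Fh (A' : EuclideanSpace ℝ (Fin d) →L[ℝ] EuclideanSpace ℝ (Fin d))
      (c x) := h2
  set h := h1.toOpenPartialHomeomorph Fh h3 one_ne_zero with hh
  have hxc : x ∈ c.source := mem_chart_source _ x
  have hxc' : F x ∈ c'.source := mem_chart_source _ (F x)
  have hU : IsOpen (F ⁻¹' c'.source) := c'.open_source.preimage hF.continuous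
  have hFx : Fh (c x) = c' (F x) := by simp [hFh, c.left_inv hxc]
  refine ⟨((c.trans h).trans c'.symm).restrOpen _ hU, ?_, ?_, ?_⟩
  · have : c x ∈ h.source := h1.mem_toOpenPartialHomeomorph_source h3 one_ne_zero
    have h4 : h (c x) = c' (F x) := hFx
    simp [hxc, this, h4, hxc', c'.map_source hxc']
  · rintro y ⟨hy, hy'⟩
    have hyc : y ∈ c.source := by simp at hy; exact hy.1.1
    change F y = c'.symm (Fh (c y))
    simp only [hFh, Function.comp_apply]
    rw [c.left_inv hyc, c'.left_inv hy']
  · change ContMDiffAt (𝓡 d) (𝓡 d) 1 (fun y => c.symm (h.symm (c' y))) (F x)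
    have h5 : h.symm (c' (F x)) = c x := by
      rw [← hFx]
      exact h1.localInverse_apply_image h3 one_ne_zero
    have k1 : ContMDiffAt (𝓡 d) 𝓘(ℝ, EuclideanSpace ℝ (Fin d)) 1 c' (F x) :=
      (contMDiffOn_chart (n := 1)).contMDiffAt (c'.open_source.mem_nhds hxc')
    have k2 : ContMDiffAt 𝓘(ℝ, EuclideanSpace ℝ (Fin d)) 𝓘(ℝ, EuclideanSpace ℝ (Fin d)) 1 h.symm
        (c' (F x)) := by
      rw [contMDiffAt_iff_contDiffAt, ← hFx]
      exact h1.to_localInverse h3 one_ne_zero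
    have k3 : ContMDiffAt 𝓘(ℝ, EuclideanSpace ℝ (Fin d)) (𝓡 d) 1 c.symm (h.symm (c' (F x))) := by
      rw [h5]
      exact (contMDiffOn_chart_symm (n := 1)).contMDiffAt
        (c.open_target.mem_nhds (c.map_source hxc))
    exact k3.comp (F x) (k2.comp (F x) k1)

end LocalInverse

end

noncomputable section

/-! ### Pairing of the fibres of an expanding map -/

section Pairing

open Manifold

variable {d : ℕ} {M : Type*} [MetricSpace M]
  [ChartedSpace (EuclideanSpace ℝ (Fin d)) M] [IsManifold (𝓡 d) ∞ M]
  [RiemannianBundle (fun x : M => TangentSpace (𝓡 d) x)]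

omit [IsManifold (𝓡 d) ∞ M] in
theorem mfderiv_injective_of_expanding {F : M → M} {θ : ℝ} (hθ : 0 < θ) {x : M}
    (hexp : ∀ v : TangentSpace (𝓡 d) x, θ * ‖v‖ ≤ ‖mfderiv (𝓡 d) (𝓡 d) F x v‖)
    (v : TangentSpace (𝓡 d) x) (hv : mfderiv (𝓡 d) (𝓡 d) F x v = 0) : v = 0 := by
  have h := hexp v
  rw [hv, norm_zero] at h
  have h1 : ‖v‖ ≤ 0 := by nlinarith [norm_nonneg v]
  exact norm_le_zero_iff.1 h1

/-- Expansion makes `F` a local homeomorphism, and a local homeomorphism of a compact Hausdorff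
space is a covering. -/
theorem isCoveringMap_of_expanding [CompactSpace M] {F : M → M}
    (hF : ContMDiff (𝓡 d) (𝓡 d) 1 F) {θ : ℝ} (hθ : 0 < θ)
    (hexp : ∀ (x : M) (v : TangentSpace (𝓡 d) x), θ * ‖v‖ ≤ ‖mfderiv (𝓡 d) (𝓡 d) F x v‖) :
    IsCoveringMap F := by
  rw [← isLocalHomeomorph_iff_isCoveringMap]
  refine IsLocalHomeomorph.mk _ fun x => ?_
  obtain ⟨e, hx, he, -⟩ := exists_local_inverse hF
    (fun v => mfderiv_injective_of_expanding hθ (hexp x) v)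
  exact ⟨e, hx, he⟩

omit [RiemannianBundle (fun x : M => TangentSpace (𝓡 d) x)] in
/-- A continuous lift of a `C¹` path by an expanding map is `C¹`. -/
theorem contMDiffOn_lift {F : M → M} (hF : ContMDiff (𝓡 d) (𝓡 d) 1 F)
    (hinj : ∀ (x : M) (v : TangentSpace (𝓡 d) x), mfderiv (𝓡 d) (𝓡 d) F x v = 0 → v = 0)
    {γ Γ : ℝ → M} {s : Set ℝ} (hγ : ContMDiff 𝓘(ℝ, ℝ) (𝓡 d) 1 γ) (hΓ : ContinuousOn Γ s)
    (hlift : ∀ t ∈ s, F (Γ t) = γ t) : ContMDiffOn 𝓘(ℝ, ℝ) (𝓡 d) 1 Γ s := by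
  intro t ht
  obtain ⟨e, hx, he, hsymm⟩ := exists_local_inverse hF (hinj (Γ t))
  rw [hlift t ht] at hsymm
  have h1 : ContMDiffWithinAt 𝓘(ℝ, ℝ) (𝓡 d) 1 (fun t => e.symm (γ t)) s t :=
    hsymm.comp_contMDiffWithinAt t (hγ t).contMDiffWithinAt
  have h2 : ∀ t' ∈ s, Γ t' ∈ e.source → Γ t' = e.symm (γ t') := by
    intro t' ht' hsrc
    rw [← hlift t' ht', he hsrc, e.left_inv hsrc]
  refine h1.congr_of_eventuallyEq ?_ (h2 t ht hx)
  filter_upwards [hΓ t ht (e.open_source.mem_nhds hx), self_mem_nhdsWithin] with t' h3 h4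
  exact h2 t' h4 h3

variable [IsRiemannianManifold (𝓡 d) M]

/-- The speed of `γ = F ∘ Γ` is at least `θ` times that of `Γ`; integrate over the unit interval. -/
theorem dist_le_of_lift {F : M → M} (hF : ContMDiff (𝓡 d) (𝓡 d) 1 F) {θ : ℝ} (hθ : 0 < θ)
    (hexp : ∀ (x : M) (v : TangentSpace (𝓡 d) x), θ * ‖v‖ ≤ ‖mfderiv (𝓡 d) (𝓡 d) F x v‖)
    {γ Γ : ℝ → M} (hγ : ContMDiff 𝓘(ℝ, ℝ) (𝓡 d) 1 γ) (hΓ : ContinuousOn Γ (Set.Icc 0 1))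
    (hlift : ∀ t ∈ Set.Icc (0 : ℝ) 1, F (Γ t) = γ t) {r : ℝ}
    (hr : pathELength (𝓡 d) γ 0 1 < ENNReal.ofReal r) : θ * dist (Γ 0) (Γ 1) ≤ r := by
  have hΓ' := contMDiffOn_lift hF
    (fun x v => mfderiv_injective_of_expanding hθ (hexp x) v) hγ hΓ hlift
  have h1 : edist (Γ 0) (Γ 1) ≤ pathELength (𝓡 d) Γ 0 1 := by
    rw [IsRiemannianManifold.out (I := 𝓡 d)]
    exact riemannianEDist_le_pathELength hΓ' rfl rfl zero_le_one
  have h2 : ENNReal.ofReal θ * pathELength (𝓡 d) Γ 0 1 ≤ pathELength (𝓡 d) γ 0 1 := by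
    rw [pathELength_eq_lintegral_mfderivWithin_Icc, pathELength_eq_lintegral_mfderivWithin_Icc,
      ← lintegral_const_mul' _ _ ENNReal.ofReal_ne_top]
    refine setLIntegral_mono_ae' measurableSet_Icc (Filter.Eventually.of_forall fun t ht => ?_)
    have hu : UniqueMDiffWithinAt 𝓘(ℝ, ℝ) (Set.Icc (0 : ℝ) 1) t :=
      (uniqueDiffOn_Icc zero_lt_one t ht).uniqueMDiffWithinAt
    have e1 : mfderivWithin 𝓘(ℝ, ℝ) (𝓡 d) γ (Set.Icc 0 1) t =
        mfderivWithin 𝓘(ℝ, ℝ) (𝓡 d) (F ∘ Γ) (Set.Icc 0 1) t :=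
      (mfderivWithin_congr (fun t' ht' => hlift t' ht') (hlift t ht)).symm
    have e2 : mfderivWithin 𝓘(ℝ, ℝ) (𝓡 d) (F ∘ Γ) (Set.Icc 0 1) t =
        (mfderiv (𝓡 d) (𝓡 d) F (Γ t)).comp (mfderivWithin 𝓘(ℝ, ℝ) (𝓡 d) Γ (Set.Icc 0 1) t) :=
      mfderiv_comp_mfderivWithin t (hF.mdifferentiable one_ne_zero _)
        (hΓ'.mdifferentiableOn one_ne_zero t ht) hu
    have e3 := hexp (Γ t) (mfderivWithin 𝓘(ℝ, ℝ) (𝓡 d) Γ (Set.Icc 0 1) t (1 : ℝ))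
    have e4 : ENNReal.ofReal θ * ‖mfderivWithin 𝓘(ℝ, ℝ) (𝓡 d) Γ (Set.Icc 0 1) t (1 : ℝ)‖ₑ ≤
        ‖mfderivWithin 𝓘(ℝ, ℝ) (𝓡 d) (F ∘ Γ) (Set.Icc 0 1) t (1 : ℝ)‖ₑ := by
      rw [e2, ← ofReal_norm, ← ofReal_norm, ← ENNReal.ofReal_mul hθ.le]
      exact ENNReal.ofReal_le_ofReal e3
    refine e4.trans_eq ?_
    -- The tangent spaces at `F (Γ t)` and `γ t` carry norms attached to base points that are only
    -- propositionally equal; generalizing the base point lets the equality be substituted.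
    have e5 : ∀ x, x = F (Γ t) → ∀ w : TangentSpace (𝓡 d) (F (Γ t)),
        ‖w‖ₑ = ‖(show TangentSpace (𝓡 d) x from w)‖ₑ := by
      rintro x rfl w; rfl
    rw [e5 (γ t) (hlift t ht).symm, ← e1]
    rfl
  have h3 := (mul_le_mul_right h1 (ENNReal.ofReal θ)).trans (h2.trans hr.le)
  rw [edist_dist, ← ENNReal.ofReal_mul hθ.le] at h3
  have hr0 : 0 < r := ENNReal.ofReal_pos.1 (lt_of_le_of_lt bot_le hr)
  exact (ENNReal.ofReal_le_ofReal_iff hr0.le).1 h3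

/-- The bijection is the monodromy along a nearly shortest path from `y` to `y'`; each lifted path
is shorter by the factor `θ`. A shortest path is not required: the slack `1 < lam * θ` leaves room
for one of slightly larger length, provided `y ≠ y'`. -/
theorem exists_fiber_equiv [CompactSpace M] {F : M → M} (hF : ContMDiff (𝓡 d) (𝓡 d) 1 F)
    {θ lam : ℝ} (hθ : 0 < θ) (hlam : 1 < lam * θ)
    (hexp : ∀ (x : M) (v : TangentSpace (𝓡 d) x), θ * ‖v‖ ≤ ‖mfderiv (𝓡 d) (𝓡 d) F x v‖)
    (y y' : M) :
    ∃ e : F ⁻¹' {y} ≃ F ⁻¹' {y'}, ∀ x : F ⁻¹' {y}, dist (x : M) (e x) ≤ lam * dist y y' := by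
  rcases eq_or_ne y y' with rfl | hne
  · exact ⟨Equiv.refl _, fun x => by simp⟩
  have hd := dist_pos.2 hne
  obtain ⟨γ, h0, h1, hγ, hl⟩ := exists_path_of_dist_lt (d := d) (x := y) (y := y')
    (r := lam * θ * dist y y') (by nlinarith)
  have cov := isCoveringMap_of_expanding hF hθ hexp
  let p : Path y y' :=
    { toFun := fun t => γ t
      continuous_toFun := hγ.continuous.comp continuous_subtype_val
      source' := by simpa using h0
      target' := by simpa using h1 }
  refine ⟨Equiv.ofBijective _ (cov.monodromy_bijective (Path.Homotopic.Quotient.mk p)),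
    fun x => ?_⟩
  set Γ := cov.liftPath p x.1 (p.source.trans x.2.symm) with hΓ
  have hend : ((cov.monodromy (Path.Homotopic.Quotient.mk p) x : F ⁻¹' {y'}) : M) = Γ 1 := rfl
  have hlifts : ∀ t, F (Γ t) = γ t := fun t =>
    congrFun (cov.liftPath_lifts p x.1 (p.source.trans x.2.symm)) t
  have hstart : Γ 0 = x := cov.liftPath_zero p x.1 (p.source.trans x.2.symm)
  have key := dist_le_of_lift hF hθ hexp hγ
    (Γ := fun t => Γ (Set.projIcc 0 1 zero_le_one t))
    (Γ.continuous.comp continuous_projIcc).continuousOn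
    (fun t ht => by rw [hlifts, Set.projIcc_of_mem _ ht]) hl
  simp only [Set.projIcc_left, Set.projIcc_right] at key
  rw [Equiv.ofBijective_apply, hend]
  have hstart' : Γ ⟨0, by simp⟩ = x := hstart
  have e1 : Γ ⟨1, by simp⟩ = Γ 1 := rfl
  rw [hstart', e1] at key
  have : θ * dist (x : M) (Γ 1) ≤ θ * (lam * dist y y') := by linarith
  exact le_of_mul_le_mul_left this hθ

end Pairing

end

noncomputable section

/-! ### Gram determinants and the Jacobian -/

section Gram

theorem Matrix.det_gram_sum_smul {n T : Type*} [Fintype n] [DecidableEq n] [NormedAddCommGroup T]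
    [InnerProductSpace ℝ T] (v : n → T) (B : Matrix n n ℝ) :
    (Matrix.gram ℝ fun j => ∑ k, B k j • v k).det = B.det ^ 2 * (Matrix.gram ℝ v).det := by
  have : (Matrix.gram ℝ fun j => ∑ k, B k j • v k) = B.transpose * Matrix.gram ℝ v * B := by
    ext i j
    simp only [Matrix.gram_apply, Matrix.mul_apply, Matrix.transpose_apply, sum_inner, inner_sum,
      real_inner_smul_left, real_inner_smul_right, Finset.sum_mul]
    refine Finset.sum_congr rfl fun _ _ => Finset.sum_congr rfl fun _ _ => by ring
  rw [this, Matrix.det_mul, Matrix.det_mul, Matrix.det_transpose]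
  ring

variable {d : ℕ}

/-- Linearity is asked of a bare function only on the canonical basis, so that the identity from the
model space into a tangent space with its Riemannian inner product is also admissible. -/
theorem det_gram_comp {T : Type*} [NormedAddCommGroup T] [InnerProductSpace ℝ T]
    (l : EuclideanSpace ℝ (Fin d) → T)
    (hl : ∀ c : Fin d → ℝ, l (∑ k, c k • EuclideanSpace.single k (1 : ℝ)) =
      ∑ k, c k • l (EuclideanSpace.single k 1))
    (B : EuclideanSpace ℝ (Fin d) →L[ℝ] EuclideanSpace ℝ (Fin d)) :
    (Matrix.gram ℝ fun i => l (B (EuclideanSpace.single i 1))).det =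
      B.det ^ 2 * (Matrix.gram ℝ fun i => l (EuclideanSpace.single i 1)).det := by
  set b := (EuclideanSpace.basisFun (Fin d) ℝ).toBasis with hb
  set Bm := LinearMap.toMatrix b b (B : EuclideanSpace ℝ (Fin d) →ₗ[ℝ] EuclideanSpace ℝ (Fin d))
    with hBm
  have h1 : ∀ i, l (B (EuclideanSpace.single i 1)) =
      ∑ k, Bm k i • l (EuclideanSpace.single k 1) := by
    intro i
    rw [← hl]
    congr 1
    have := b.sum_repr (B (EuclideanSpace.single i 1))
    rw [← this]
    refine Finset.sum_congr rfl fun k _ => ?_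
    rw [hBm, LinearMap.toMatrix_apply]
    simp [hb]
  simp only [h1]
  rw [Matrix.det_gram_sum_smul, hBm, LinearMap.det_toMatrix]

variable {M : Type*} [TopologicalSpace M] [ChartedSpace (EuclideanSpace ℝ (Fin d)) M]
  [RiemannianBundle (fun x : M => TangentSpace (𝓡 d) x)]

/-- The Gram determinant of the partial derivatives of a parametrization. -/
def paramGram (Φ : EuclideanSpace ℝ (Fin d) → M) (y : EuclideanSpace ℝ (Fin d)) : ℝ :=
  (Matrix.gram (E := TangentSpace (𝓡 d) (Φ y)) ℝ fun i => mfderiv (𝓡 d) (𝓡 d) Φ y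
    (EuclideanSpace.single i (1 : ℝ) : EuclideanSpace ℝ (Fin d))).det

/-- The Gram determinant of the vectors of the canonical basis of the model space, seen as tangent
vectors at `x`. -/
def baseGram (x : M) : ℝ :=
  (Matrix.gram (E := TangentSpace (𝓡 d) x) ℝ fun i =>
    (EuclideanSpace.single i (1 : ℝ) : EuclideanSpace ℝ (Fin d))).det

/-- The Jacobian of `F` with respect to the Riemannian volume. -/
def jacobian (F : M → M) (x : M) : ℝ :=
  √((Matrix.gram (E := TangentSpace (𝓡 d) (F x)) ℝ fun i => mfderiv (𝓡 d) (𝓡 d) F x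
    (EuclideanSpace.single i (1 : ℝ) : EuclideanSpace ℝ (Fin d))).det) / √(baseGram (d := d) x)

/-- The derivative of a parametrization, in the coordinates of the preferred chart at its value. -/
def paramDeriv (φ : EuclideanSpace ℝ (Fin d) → M) (y : EuclideanSpace ℝ (Fin d)) :
    EuclideanSpace ℝ (Fin d) →L[ℝ] EuclideanSpace ℝ (Fin d) :=
  mfderiv (𝓡 d) (𝓡 d) φ y

theorem map_sum_smul_single {T : Type*} [AddCommGroup T] [Module ℝ T]
    (l : EuclideanSpace ℝ (Fin d) →ₗ[ℝ] T) (c : Fin d → ℝ) :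
    l (∑ k, c k • EuclideanSpace.single k (1 : ℝ)) =
      ∑ k, c k • l (EuclideanSpace.single k 1) := by
  rw [map_sum]; simp only [map_smul]

theorem paramGram_comp {φ : EuclideanSpace ℝ (Fin d) → M}
    {τ : EuclideanSpace ℝ (Fin d) → EuclideanSpace ℝ (Fin d)} {y : EuclideanSpace ℝ (Fin d)}
    (hφ : MDifferentiableAt (𝓡 d) (𝓡 d) φ (τ y)) (hτ : DifferentiableAt ℝ τ y) :
    paramGram (φ ∘ τ) y = (fderiv ℝ τ y).det ^ 2 * paramGram φ (τ y) := by
  have := det_gram_comp (T := TangentSpace (𝓡 d) (φ (τ y)))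
    (fun v => mfderiv (𝓡 d) (𝓡 d) φ (τ y) v)
    (map_sum_smul_single (mfderiv (𝓡 d) (𝓡 d) φ (τ y)).toLinearMap)
    (fderiv ℝ τ y)
  rw [paramGram, mfderiv_comp y hφ hτ.mdifferentiableAt, mfderiv_eq_fderiv]
  exact this

theorem paramGram_eq_base {φ : EuclideanSpace ℝ (Fin d) → M} {y : EuclideanSpace ℝ (Fin d)} :
    paramGram φ y = (paramDeriv φ y).det ^ 2 * baseGram (d := d) (φ y) :=
  det_gram_comp (T := TangentSpace (𝓡 d) (φ y)) (fun v => v) (fun _ => rfl) (paramDeriv φ y)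

theorem paramGram_map_comp {F : M → M} {φ : EuclideanSpace ℝ (Fin d) → M}
    {y : EuclideanSpace ℝ (Fin d)} (hF : MDifferentiableAt (𝓡 d) (𝓡 d) F (φ y))
    (hφ : MDifferentiableAt (𝓡 d) (𝓡 d) φ y) :
    paramGram (F ∘ φ) y = (paramDeriv φ y).det ^ 2 *
      (Matrix.gram (E := TangentSpace (𝓡 d) (F (φ y))) ℝ fun i => mfderiv (𝓡 d) (𝓡 d) F (φ y)
        (EuclideanSpace.single i (1 : ℝ) : EuclideanSpace ℝ (Fin d))).det := by
  have := det_gram_comp (T := TangentSpace (𝓡 d) (F (φ y)))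
    (fun v => mfderiv (𝓡 d) (𝓡 d) F (φ y) v)
    (map_sum_smul_single (mfderiv (𝓡 d) (𝓡 d) F (φ y)).toLinearMap)
    (paramDeriv φ y)
  rw [paramGram, mfderiv_comp y hF hφ]
  exact this

omit [RiemannianBundle (fun x : M => TangentSpace (𝓡 d) x)] in
theorem linearIndependent_single_tangent (x : M) : LinearIndependent ℝ
    (M := TangentSpace (𝓡 d) x) (fun i : Fin d =>
      (EuclideanSpace.single i (1 : ℝ) : EuclideanSpace ℝ (Fin d))) := by
  have h := (EuclideanSpace.basisFun (Fin d) ℝ).toBasis.linearIndependent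
  have : ⇑(EuclideanSpace.basisFun (Fin d) ℝ).toBasis =
      fun i => (EuclideanSpace.single i (1 : ℝ) : EuclideanSpace ℝ (Fin d)) := by
    funext i; simp
  rw [this] at h
  exact h

theorem baseGram_pos (x : M) : 0 < baseGram (d := d) x := by
  have hl := linearIndependent_single_tangent (d := d) x
  exact (Matrix.posDef_gram_of_linearIndependent hl).det_pos

/-- Both Gram determinants carry the same factor, the squared determinant of the derivative of `φ`;
what is left is a ratio that does not depend on the parametrization. -/
theorem sqrt_paramGram_map_comp {F : M → M} {φ : EuclideanSpace ℝ (Fin d) → M}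
    {y : EuclideanSpace ℝ (Fin d)} (hF : MDifferentiableAt (𝓡 d) (𝓡 d) F (φ y))
    (hφ : MDifferentiableAt (𝓡 d) (𝓡 d) φ y) :
    √(paramGram (F ∘ φ) y) = jacobian (d := d) F (φ y) * √(paramGram φ y) := by
  rw [paramGram_map_comp hF hφ, paramGram_eq_base, Real.sqrt_mul (sq_nonneg _),
    Real.sqrt_mul (sq_nonneg _), jacobian]
  have := (Real.sqrt_pos.2 (baseGram_pos (d := d) (φ y))).ne'
  field_simp

theorem jacobian_pos {F : M → M} {x : M}
    (hinj : ∀ v : TangentSpace (𝓡 d) x, mfderiv (𝓡 d) (𝓡 d) F x v = 0 → v = 0) :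
    0 < jacobian (d := d) F x := by
  refine div_pos (Real.sqrt_pos.2 ?_) (Real.sqrt_pos.2 (baseGram_pos (d := d) x))
  have hl := linearIndependent_single_tangent (d := d) x
  have hk := hl.map' (mfderiv (𝓡 d) (𝓡 d) F x).toLinearMap (LinearMap.ker_eq_bot'.2 hinj)
  exact (Matrix.posDef_gram_of_linearIndependent (E := TangentSpace (𝓡 d) (F x)) hk).det_pos

end Gram

section Smooth

variable {d : ℕ} {M : Type*} [TopologicalSpace M] [ChartedSpace (EuclideanSpace ℝ (Fin d)) M]
  [IsManifold (𝓡 d) ∞ M] [RiemannianBundle (fun x : M => TangentSpace (𝓡 d) x)]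
  [IsContMDiffRiemannianBundle (𝓡 d) ∞ (EuclideanSpace ℝ (Fin d))
    (fun x : M => TangentSpace (𝓡 d) x)]

/-- One derivative is lost: the partial derivatives of a `C²` parametrization are `C¹` sections
along it, and the metric pairs them smoothly. -/
theorem contDiffOn_paramGram {Φ : EuclideanSpace ℝ (Fin d) → M} {U : Set (EuclideanSpace ℝ (Fin d))}
    (hU : IsOpen U) (hΦ : ContMDiffOn (𝓡 d) (𝓡 d) 2 Φ U) : ContDiffOn ℝ 1 (paramGram Φ) U := by
  have : IsContMDiffRiemannianBundle (𝓡 d) 1 (EuclideanSpace ℝ (Fin d))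
    (fun x : M => TangentSpace (𝓡 d) x) := .of_le (n := ∞) (by norm_cast)
  have hsec : ∀ v : EuclideanSpace ℝ (Fin d), ContMDiffOn (𝓡 d) ((𝓡 d).prod (𝓡 d)) 1
      (fun y => (⟨Φ y, mfderiv (𝓡 d) (𝓡 d) Φ y v⟩ : TangentBundle (𝓡 d) M)) U := by
    intro v
    have h1 := hΦ.contMDiffOn_tangentMapWithin (m := 1) (by norm_num) hU.uniqueMDiffOn
    have h2 : ContMDiffOn (𝓡 d) ((𝓡 d).prod (𝓡 d)) 1
        (fun y : EuclideanSpace ℝ (Fin d) =>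
          (⟨y, v⟩ : TangentBundle (𝓡 d) (EuclideanSpace ℝ (Fin d))))
        U := (contMDiff_vectorSpace_iff_contDiff.2 contDiff_const).contMDiffOn
    refine (h1.comp h2 fun y hy => hy).congr fun y hy => ?_
    simp only [Function.comp_apply, tangentMapWithin]
    rw [mfderivWithin_of_isOpen hU hy]
  unfold paramGram
  simp only [Matrix.det_apply]
  refine ContDiffOn.sum fun σ _ => ContDiffOn.const_smul _ (contDiffOn_prod fun i _ => ?_)
  simp only [Matrix.gram_apply]
  rw [← contMDiffOn_iff_contDiffOn]
  exact (hsec _).inner_bundle (hsec _)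

end Smooth

end

noncomputable section

/-! ### The Riemannian volume in charts -/

section Volume

variable {d : ℕ} {M : Type*} [TopologicalSpace M] [T2Space M]
  [ChartedSpace (EuclideanSpace ℝ (Fin d)) M] [IsManifold (𝓡 d) ∞ M]
  [RiemannianBundle (fun x : M => TangentSpace (𝓡 d) x)] [MeasurableSpace M] [BorelSpace M]

omit [T2Space M] [IsManifold (𝓡 d) ∞ M] [MeasurableSpace M] [BorelSpace M] in
theorem chartGram_det (c : M) (y : EuclideanSpace ℝ (Fin d)) :
    (chartGram c y).det = paramGram (chartAt (EuclideanSpace ℝ (Fin d)) c).symm y := rfl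

omit [T2Space M] [IsManifold (𝓡 d) ∞ M]
  [RiemannianBundle (fun x : M => TangentSpace (𝓡 d) x)] in
theorem measurableSet_chart_image (c : M) {A : Set M} (hA : MeasurableSet A) :
    MeasurableSet ((chartAt (EuclideanSpace ℝ (Fin d)) c) ''
      (A ∩ (chartAt (EuclideanSpace ℝ (Fin d)) c).source)) := by
  set φ := chartAt (EuclideanSpace ℝ (Fin d)) c
  have h1 : φ '' (A ∩ φ.source) = φ.target ∩ φ.symm ⁻¹' A := by
    rw [Set.inter_comm, φ.image_source_inter_eq']
  rw [h1]
  have h2 : Measurable (φ.target.domRestrict φ.symm) :=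
    (continuousOn_iff_continuous_domRestrict.1 φ.continuousOn_symm).measurable
  have h3 := φ.open_target.measurableSet.subtype_image (h2 hA)
  convert h3 using 1
  ext y
  simp [Set.domRestrict, and_comm]

omit [T2Space M] [IsManifold (𝓡 d) ∞ M] in
theorem chartVolume_apply (c : M) {A : Set M} (hA : MeasurableSet A) :
    chartVolume (d := d) c A =
      ∫⁻ y in (chartAt (EuclideanSpace ℝ (Fin d)) c) ''
        (A ∩ (chartAt (EuclideanSpace ℝ (Fin d)) c).source),
        ENNReal.ofReal √(paramGram (chartAt (EuclideanSpace ℝ (Fin d)) c).symm y) := by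
  set φ := chartAt (EuclideanSpace ℝ (Fin d)) c with hφ
  have hT := φ.open_target.measurableSet
  have hae : AEMeasurable φ.symm (((volume : Measure (EuclideanSpace ℝ (Fin d))).restrict
      φ.target).withDensity fun y => ENNReal.ofReal (Real.sqrt (chartGram c y).det)) :=
    (φ.continuousOn_symm.aemeasurable hT).mono_ac (withDensity_absolutelyContinuous _ _)
  have hS := measurableSet_chart_image (d := d) c hA
  rw [← hφ] at hS
  have h1 : φ '' (A ∩ φ.source) = φ.target ∩ φ.symm ⁻¹' A := by
    rw [Set.inter_comm, φ.image_source_inter_eq']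
  rw [chartVolume, Measure.map_apply_of_aemeasurable hae hA]
  set ν := ((volume : Measure (EuclideanSpace ℝ (Fin d))).restrict
      φ.target).withDensity fun y => ENNReal.ofReal (Real.sqrt (chartGram c y).det) with hν
  have h2 : ν φ.targetᶜ = 0 := by
    rw [hν, withDensity_apply _ hT.compl, Measure.restrict_restrict hT.compl]
    simp
  have h3 : ν (φ.symm ⁻¹' A) = ν (φ '' (A ∩ φ.source)) := by
    refine le_antisymm ?_ (measure_mono (by rw [h1]; exact Set.inter_subset_right))
    calc ν (φ.symm ⁻¹' A) ≤ ν (φ '' (A ∩ φ.source) ∪ φ.targetᶜ) := measure_mono (by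
          rw [h1]
          intro y hy
          by_cases hyt : y ∈ φ.target
          · exact Or.inl ⟨hyt, hy⟩
          · exact Or.inr hyt)
      _ ≤ ν (φ '' (A ∩ φ.source)) + ν φ.targetᶜ := measure_union_le _ _
      _ = _ := by rw [h2, add_zero]
  rw [h3, hν, withDensity_apply _ hS, Measure.restrict_restrict hS]
  have h4 : φ '' (A ∩ φ.source) ∩ φ.target = φ '' (A ∩ φ.source) :=
    Set.inter_eq_left.2 (by rw [h1]; exact Set.inter_subset_left)
  rw [h4]
  rfl

/-- The volume of the image of an injective parametrization contained in a chart domain. -/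
theorem chartVolume_image {Φ : EuclideanSpace ℝ (Fin d) → M} {S : Set (EuclideanSpace ℝ (Fin d))}
    (hS : MeasurableSet S) (c : M) (hΦ : ∀ y ∈ S, MDifferentiableAt (𝓡 d) (𝓡 d) Φ y)
    (hinj : Set.InjOn Φ S)
    (hmem : ∀ y ∈ S, Φ y ∈ (chartAt (EuclideanSpace ℝ (Fin d)) c).source) :
    chartVolume (d := d) c (Φ '' S) = ∫⁻ y in S, ENNReal.ofReal √(paramGram Φ y) := by
  set φ := chartAt (EuclideanSpace ℝ (Fin d)) c with hφ
  have hcont : ContinuousOn Φ S := fun y hy => (hΦ y hy).continuousAt.continuousWithinAt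
  have hmeas : MeasurableSet (Φ '' S) := hS.image_of_continuousOn_injOn hcont hinj
  rw [chartVolume_apply c hmeas, ← hφ]
  have h1 : φ '' (Φ '' S ∩ φ.source) = (φ ∘ Φ) '' S := by
    rw [Set.inter_eq_left.2 (Set.image_subset_iff.2 hmem), Set.image_image]
    rfl
  have hdiff : ∀ y ∈ S, DifferentiableAt ℝ (φ ∘ Φ) y := fun y hy => by
    have h2 : MDifferentiableAt (𝓡 d) 𝓘(ℝ, EuclideanSpace ℝ (Fin d)) φ (Φ y) :=
      mdifferentiableAt_atlas (chart_mem_atlas _ c) (hmem y hy)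
    exact (h2.comp y (hΦ y hy)).differentiableAt
  have hinj' : Set.InjOn (φ ∘ Φ) S := fun y hy z hz hyz =>
    hinj hy hz (φ.injOn (hmem y hy) (hmem z hz) hyz)
  rw [h1, lintegral_image_eq_lintegral_abs_det_fderiv_mul _ hS
    (fun y hy => (hdiff y hy).hasFDerivAt.hasFDerivWithinAt) hinj']
  refine setLIntegral_congr_fun hS fun y hy => ?_
  have hτ : φ.target ∈ nhds ((φ ∘ Φ) y) :=
    φ.open_target.mem_nhds (φ.map_source (hmem y hy))
  have h3 : MDifferentiableAt (𝓡 d) (𝓡 d) φ.symm ((φ ∘ Φ) y) :=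
    mdifferentiableAt_atlas_symm (chart_mem_atlas _ c) (φ.map_source (hmem y hy))
  have h4 := paramGram_comp h3 (hdiff y hy)
  have h5 : φ.symm ∘ (φ ∘ Φ) =ᶠ[nhds y] Φ := by
    filter_upwards [(hΦ y hy).continuousAt (φ.open_source.mem_nhds (hmem y hy))] with z hz
    exact φ.left_inv hz
  have h6 : paramGram (φ.symm ∘ (φ ∘ Φ)) y = paramGram Φ y := by
    have key : ∀ (x : M) (L : EuclideanSpace ℝ (Fin d) →L[ℝ] EuclideanSpace ℝ (Fin d)),
        x = Φ y → L = paramDeriv Φ y →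
        (Matrix.gram (E := TangentSpace (𝓡 d) x) ℝ fun i => L
          (EuclideanSpace.single i (1 : ℝ) : EuclideanSpace ℝ (Fin d))).det = paramGram Φ y := by
      rintro x L rfl rfl; rfl
    exact key _ (paramDeriv (φ.symm ∘ (φ ∘ Φ)) y) h5.eq_of_nhds h5.mfderiv_eq
  rw [← h6, h4, Real.sqrt_mul (sq_nonneg _), Real.sqrt_sq_eq_abs,
    ENNReal.ofReal_mul (abs_nonneg _)]

theorem chartVolume_eq_of_subset (c c' : M) {A : Set M} (hA : MeasurableSet A)
    (hc : A ⊆ (chartAt (EuclideanSpace ℝ (Fin d)) c).source)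
    (hc' : A ⊆ (chartAt (EuclideanSpace ℝ (Fin d)) c').source) :
    chartVolume (d := d) c' A = chartVolume (d := d) c A := by
  set φ := chartAt (EuclideanSpace ℝ (Fin d)) c with hφ
  have hS := measurableSet_chart_image (d := d) c hA
  rw [← hφ] at hS
  have hsub : φ '' (A ∩ φ.source) ⊆ φ.target := by
    rintro _ ⟨x, hx, rfl⟩
    exact φ.map_source hx.2
  have himg : φ.symm '' (φ '' (A ∩ φ.source)) = A := by
    rw [Set.inter_eq_left.2 hc, Set.image_image]
    exact (Set.image_congr fun x hx => φ.left_inv (hc hx)).trans (Set.image_id _)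
  have h := chartVolume_image hS c' (Φ := φ.symm)
    (fun y hy => mdifferentiableAt_atlas_symm (chart_mem_atlas _ c) (hsub hy))
    (φ.symm.injOn.mono hsub)
    (fun y hy => hc' (himg ▸ Set.mem_image_of_mem φ.symm hy))
  rw [himg] at h
  rw [h, chartVolume_apply c hA]

omit [T2Space M] [IsManifold (𝓡 d) ∞ M] in
theorem chartVolume_inter_source (c : M) {A : Set M} (hA : MeasurableSet A) :
    chartVolume (d := d) c (A ∩ (chartAt (EuclideanSpace ℝ (Fin d)) c).source) =
      chartVolume (d := d) c A := by
  rw [chartVolume_apply c hA, chartVolume_apply c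
    (hA.inter (chartAt (EuclideanSpace ℝ (Fin d)) c).open_source.measurableSet), Set.inter_assoc,
    Set.inter_self]

/-- A supremum of measures is not computed set by set, so the upper bound comes from exhibiting a
measure above every chart volume: the one of `c` plus the total volume restricted to the complement
of its domain. The latter does not charge `A`. -/
theorem riemannianVolume_eq_chartVolume (c : M) {A : Set M} (hA : MeasurableSet A)
    (hc : A ⊆ (chartAt (EuclideanSpace ℝ (Fin d)) c).source) :
    riemannianVolume d M A = chartVolume (d := d) c A := by
  set s := (chartAt (EuclideanSpace ℝ (Fin d)) c).source with hs
  have hsm : MeasurableSet s := (chartAt (EuclideanSpace ℝ (Fin d)) c).open_source.measurableSet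
  refine le_antisymm ?_ (le_iSup (fun c : M => chartVolume (d := d) c) c A)
  have hle : riemannianVolume d M ≤
      chartVolume (d := d) c + (riemannianVolume d M).restrict sᶜ := by
    refine iSup_le fun c' => Measure.le_iff.2 fun B hB => ?_
    have h1 : chartVolume (d := d) c' (B ∩ s) ≤ chartVolume (d := d) c B := by
      rw [← chartVolume_inter_source c' (hB.inter hsm)]
      have hs' := (chartAt (EuclideanSpace ℝ (Fin d)) c').open_source.measurableSet
      rw [chartVolume_eq_of_subset c c' ((hB.inter hsm).inter hs')
        (fun x hx => hx.1.2) (fun x hx => hx.2)]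
      exact measure_mono fun x hx => hx.1.1
    have h2 : chartVolume (d := d) c' (B \ s) ≤ (riemannianVolume d M).restrict sᶜ B := by
      rw [Measure.restrict_apply hB]
      exact le_iSup (fun c : M => chartVolume (d := d) c) c' (B \ s)
    calc chartVolume (d := d) c' B = chartVolume (d := d) c' (B ∩ s)
          + chartVolume (d := d) c' (B \ s) := (measure_inter_add_sdiff B hsm).symm
      _ ≤ _ := add_le_add h1 h2
  have h := hle A
  rw [Measure.add_apply, Measure.restrict_apply hA] at h
  have : A ∩ sᶜ = ∅ := by
    ext x; simp only [Set.mem_inter_iff, Set.mem_compl_iff, Set.mem_empty_iff_false, iff_false]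
    exact fun hx => hx.2 (hc hx.1)
  simpa [this] using h

end Volume

end

noncomputable section

/-! ### Duality for the transfer operator of a local diffeomorphism -/

section Duality

variable {M : Type*} [MetricSpace M] [CompactSpace M] {F : M → M} {J : M → ℝ}

omit [MetricSpace M] [CompactSpace M] in
theorem Set.InjOn.subsingleton_fiber {U : Set M} (hU : Set.InjOn F U) (y : M) :
    (F ⁻¹' {y} ∩ U).Subsingleton := fun x hx z hz =>
  hU hx.2 hz.2 ((show F x = y from hx.1).trans (show F z = y from hz.1).symm)

theorem finite_fiber_of_locally_injective (h : ∀ x, ∃ U ∈ nhds x, Set.InjOn F U) (y : M) :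
    (F ⁻¹' {y}).Finite := by
  have := isCompact_univ.induction_on (X := M) (p := fun S => (F ⁻¹' {y} ∩ S).Finite)
    (by simp) (fun s t hst ht => ht.subset (Set.inter_subset_inter_right _ hst))
    (fun s t hs ht => by rw [Set.inter_union_distrib_left]; exact hs.union ht)
    (fun x _ => by
      obtain ⟨U, hU, hinj⟩ := h x
      exact ⟨U, mem_nhdsWithin_of_mem_nhds hU, (hinj.subsingleton_fiber y).finite⟩)
  simpa using this

omit [MetricSpace M] [CompactSpace M] in
theorem transfer_indicator_apply_of_mem {A : Set M} (hA : Set.InjOn F A) (ψ : M → ℝ) {x : M}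
    (hx : x ∈ A) : transfer F J (A.indicator ψ) (F x) = ψ x / J x := by
  rw [transfer, finsum_eq_single _ (⟨x, rfl⟩ : F ⁻¹' {F x})]
  · simp [hx]
  · rintro ⟨z, hz⟩ hne
    have : z ∉ A := fun hzA => hne (Subtype.ext (hA hzA hx hz))
    simp [this]

omit [MetricSpace M] [CompactSpace M] in
theorem transfer_indicator_apply_of_notMem {A : Set M} (ψ : M → ℝ) {y : M}
    (hy : y ∉ F '' A) : transfer F J (A.indicator ψ) y = 0 := by
  rw [transfer]
  refine finsum_eq_zero_of_forall_eq_zero fun ⟨z, hz⟩ => ?_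
  have : z ∉ A := fun hzA => hy ⟨z, hzA, hz⟩
  simp [this]

omit [MetricSpace M] [CompactSpace M] in
theorem transfer_add (hfin : ∀ y, (F ⁻¹' {y}).Finite) (ψ₁ ψ₂ : M → ℝ) (y : M) :
    transfer F J (ψ₁ + ψ₂) y = transfer F J ψ₁ y + transfer F J ψ₂ y := by
  have := (hfin y).to_subtype
  rw [transfer, transfer, transfer, ← finsum_add_distrib (Set.toFinite _) (Set.toFinite _)]
  simp only [Pi.add_apply, add_div]

variable [MeasurableSpace M] [BorelSpace M] {μ : Measure M} [IsFiniteMeasure μ]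

omit [CompactSpace M] [IsFiniteMeasure μ] in
theorem map_withDensity_eq_restrict_image (hF : Continuous F) {U : Set M} (hU : MeasurableSet U)
    (hvol : ∀ A, MeasurableSet A → A ⊆ U →
      μ (F '' A) = ∫⁻ x in A, ENNReal.ofReal (J x) ∂μ) :
    μ.restrict (F '' U) = ((μ.withDensity fun x => ENNReal.ofReal (J x)).comap
      ((↑) : U → M)).map (fun x : U => F x) := by
  refine Measure.ext fun B hB => ?_
  have hm : MeasurableSet (F ⁻¹' B) := hF.measurable hB
  have hFm : Measurable fun x : U => F x := hF.measurable.comp measurable_subtype_coe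
  rw [Measure.map_apply hFm hB,
    Measure.restrict_apply hB,
    (MeasurableEmbedding.subtype_coe hU).comap_apply]
  have h1 : B ∩ F '' U = F '' (F ⁻¹' B ∩ U) := by rw [Set.image_preimage_inter]
  have h2 : ((↑) : U → M) '' ((fun x : U => F x) ⁻¹' B) = F ⁻¹' B ∩ U := by
    ext x; simp [and_comm]
  rw [h1, h2, hvol _ (hm.inter hU) Set.inter_subset_right, withDensity_apply _ (hm.inter hU)]

/-- On the image of a set where `F` is injective the transfer sum has a single term `ψ / J`, and the
identity is the change of variables formula. -/
theorem integral_transfer_indicator_of_injOn (hF : Continuous F) (hJ : Continuous J)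
    (hJ0 : ∀ x, 0 < J x) {A : Set M} (hA : MeasurableSet A) (hinj : Set.InjOn F A)
    (hvol : ∀ B, MeasurableSet B → B ⊆ A →
      μ (F '' B) = ∫⁻ x in B, ENNReal.ofReal (J x) ∂μ)
    {φ ψ : M → ℝ} (hφ : Continuous φ) (hψ : Continuous ψ) :
    Integrable (fun y => φ y * transfer F J (A.indicator ψ) y) μ ∧
      ∫ x in A, φ (F x) * ψ x ∂μ = ∫ y, φ y * transfer F J (A.indicator ψ) y ∂μ := by
  have hFA : MeasurableSet (F '' A) := hA.image_of_continuousOn_injOn hF.continuousOn hinj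
  have he : MeasurableEmbedding (fun x : A => F x) := by
    refine ⟨fun x y hxy => Subtype.ext (hinj x.2 y.2 hxy),
      hF.measurable.comp measurable_subtype_coe, fun s hs => ?_⟩
    have : (fun x : A => F x) '' s = F '' (((↑) : A → M) '' s) := by rw [Set.image_image]
    rw [this]
    exact (hA.subtype_image hs).image_of_continuousOn_injOn hF.continuousOn
      (hinj.mono (Subtype.coe_image_subset _ _))
  have hmap := map_withDensity_eq_restrict_image hF hA hvol
  set Θ := fun y => φ y * transfer F J (A.indicator ψ) y with hΘ
  have hΘ0 : ∀ y, y ∉ F '' A → Θ y = 0 := fun y hy => by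
    simp only [hΘ, transfer_indicator_apply_of_notMem ψ hy, mul_zero]
  have hΘ1 : ∀ x : A, Θ (F x) = φ (F x) * (ψ x / J x) := fun x => by
    simp only [hΘ, transfer_indicator_apply_of_mem hinj ψ x.2]
  have hind : (F '' A).indicator Θ = Θ :=
    Set.indicator_eq_self.2 fun y hy => by_contra fun h => hy (hΘ0 y h)
  have hJm : Measurable fun x => ENNReal.ofReal (J x) := by fun_prop
  have hsub := MeasurableEmbedding.subtype_coe hA
  constructor
  · rw [← hind, integrable_indicator_iff hFA, IntegrableOn, hmap, he.integrable_map_iff]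
    have h1 : (Θ ∘ fun x : A => F x) = (fun x => φ (F x) * (ψ x / J x)) ∘ ((↑) : A → M) :=
      funext hΘ1
    rw [h1, ← hsub.integrable_map_iff, hsub.map_comap, Subtype.range_coe,
      restrict_withDensity hA, integrable_withDensity_iff_integrable_smul' hJm (by simp)]
    refine Integrable.restrict ?_
    exact Continuous.integrable_of_compact (by
      simp only [ENNReal.toReal_ofReal (hJ0 _).le]
      exact hJ.smul ((hφ.comp hF).mul (hψ.div hJ fun x => (hJ0 x).ne')))
  · rw [← hind, integral_indicator hFA, hmap, he.integral_map]
    simp only [hΘ1]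
    rw [← hsub.integral_map (μ := Measure.comap _ _) (g := fun x => φ (F x) * (ψ x / J x)),
      hsub.map_comap, Subtype.range_coe, restrict_withDensity hA,
      integral_withDensity_eq_integral_toReal_smul hJm (by simp)]
    refine integral_congr_ae (Filter.Eventually.of_forall fun x => ?_)
    have := (hJ0 x).ne'
    simp only [ENNReal.toReal_ofReal (hJ0 _).le, smul_eq_mul]
    field_simp

theorem integral_comp_mul_eq_integral_mul_transfer (hF : Continuous F) (hJ : Continuous J)
    (hJ0 : ∀ x, 0 < J x)
    (hloc : ∀ x, ∃ U ∈ nhds x, MeasurableSet U ∧ Set.InjOn F U ∧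
      ∀ A, MeasurableSet A → A ⊆ U → μ (F '' A) = ∫⁻ x in A, ENNReal.ofReal (J x) ∂μ)
    {φ ψ : M → ℝ} (hφ : Continuous φ) (hψ : Continuous ψ) :
    ∫ x, φ (F x) * ψ x ∂μ = ∫ y, φ y * transfer F J ψ y ∂μ := by
  have hfin := finite_fiber_of_locally_injective (F := F) fun x =>
    (hloc x).imp fun U h => ⟨h.1, h.2.2.1⟩
  have hint : Integrable (fun x => φ (F x) * ψ x) μ :=
    Continuous.integrable_of_compact ((hφ.comp hF).mul hψ)
  -- The property is required for all measurable subsets of `S'`, so that a subset of a union can be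
  -- cut into disjoint pieces. Integrability is carried along because the integrals of the pieces
  -- must be added.
  obtain ⟨S, hS, hS', hSA⟩ := isCompact_univ.induction_on (X := M)
    (p := fun S => ∃ S', S ⊆ S' ∧ MeasurableSet S' ∧ ∀ A, MeasurableSet A → A ⊆ S' →
      Integrable (fun y => φ y * transfer F J (A.indicator ψ) y) μ ∧
      ∫ x in A, φ (F x) * ψ x ∂μ = ∫ y, φ y * transfer F J (A.indicator ψ) y ∂μ)
    ⟨∅, subset_rfl, MeasurableSet.empty, fun A _ hA => by
      rw [Set.subset_empty_iff.1 hA]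
      simp [transfer]⟩
    (fun s t hst ⟨S', h1, h2⟩ => ⟨S', hst.trans h1, h2⟩)
    (by
      rintro s t ⟨S, hsS, hS, h1⟩ ⟨T, htT, hT, h2⟩
      refine ⟨S ∪ T, Set.union_subset_union hsS htT, hS.union hT, fun A hA hAST => ?_⟩
      obtain ⟨i1, e1⟩ := h1 (A ∩ S) (hA.inter hS) Set.inter_subset_right
      obtain ⟨i2, e2⟩ := h2 (A \ S) (hA.diff hS) fun x hx => (hAST hx.1).resolve_left hx.2
      have hsum : A.indicator ψ = (A ∩ S).indicator ψ + (A \ S).indicator ψ := by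
        funext x
        by_cases hx : x ∈ A <;> by_cases hxS : x ∈ S <;> simp [hx, hxS]
      have hfun : (fun y => φ y * transfer F J (A.indicator ψ) y) =
          fun y => φ y * transfer F J ((A ∩ S).indicator ψ) y +
            φ y * transfer F J ((A \ S).indicator ψ) y := by
        funext y
        rw [hsum, transfer_add hfin, mul_add]
      rw [hfun]
      refine ⟨i1.add i2, ?_⟩
      rw [integral_add i1 i2, ← e1, ← e2, integral_inter_add_sdiff hS hint.integrableOn])
    (fun x _ => by
      obtain ⟨U, hU, hUm, hinj, hvol⟩ := hloc x
      exact ⟨U, mem_nhdsWithin_of_mem_nhds hU, U, subset_rfl, hUm, fun A hA hAU =>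
        integral_transfer_indicator_of_injOn hF hJ hJ0 hA (hinj.mono hAU)
          (fun B hB hBA => hvol B hB (hBA.trans hAU)) hφ hψ⟩)
  have := (hSA Set.univ MeasurableSet.univ hS).2
  simpa using this

end Duality

end

noncomputable section

/-! ### Smoothness of the Jacobian and the change of variables formula -/

section Jacobian

variable {d : ℕ} {M : Type*} [TopologicalSpace M]
  [ChartedSpace (EuclideanSpace ℝ (Fin d)) M] [IsManifold (𝓡 d) ∞ M]
  [RiemannianBundle (fun x : M => TangentSpace (𝓡 d) x)]

omit [IsManifold (𝓡 d) ∞ M] in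
theorem paramGram_pos {Φ : EuclideanSpace ℝ (Fin d) → M} {y : EuclideanSpace ℝ (Fin d)}
    (hinj : ∀ v : EuclideanSpace ℝ (Fin d), paramDeriv Φ y v = 0 → v = 0) :
    0 < paramGram Φ y := by
  have hl := linearIndependent_single_tangent (d := d) (Φ y)
  have hk := hl.map' (paramDeriv Φ y).toLinearMap (LinearMap.ker_eq_bot'.2 hinj)
  exact (Matrix.posDef_gram_of_linearIndependent (E := TangentSpace (𝓡 d) (Φ y)) hk).det_pos

theorem paramGram_chart_symm_pos (c : M) {y : EuclideanSpace ℝ (Fin d)}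
    (hy : y ∈ (chartAt (EuclideanSpace ℝ (Fin d)) c).target) :
    0 < paramGram (chartAt (EuclideanSpace ℝ (Fin d)) c).symm y := by
  refine paramGram_pos fun v hv => ?_
  have h := (mdifferentiable_chart (I := 𝓡 d) c).symm.ker_mfderiv_eq_bot hy
  exact LinearMap.ker_eq_bot'.1 h v hv

/-- The definition uses the preferred chart at each point, which need not vary continuously. In one
fixed chart the Jacobian becomes a quotient whose regularity can be read off. -/
theorem jacobian_eq_div {F : M → M} (c : M) (hF : ContMDiff (𝓡 d) (𝓡 d) 1 F) {x : M}
    (hx : x ∈ (chartAt (EuclideanSpace ℝ (Fin d)) c).source) :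
    jacobian (d := d) F x =
      √(paramGram (F ∘ (chartAt (EuclideanSpace ℝ (Fin d)) c).symm)
        (chartAt (EuclideanSpace ℝ (Fin d)) c x)) /
      √(paramGram (chartAt (EuclideanSpace ℝ (Fin d)) c).symm
        (chartAt (EuclideanSpace ℝ (Fin d)) c x)) := by
  set φ := chartAt (EuclideanSpace ℝ (Fin d)) c with hφ
  have hy := φ.map_source hx
  have h := sqrt_paramGram_map_comp (hF.mdifferentiable one_ne_zero (φ.symm (φ x)))
    (mdifferentiableAt_atlas_symm (chart_mem_atlas _ c) hy)
  have hp := (Real.sqrt_pos.2 (paramGram_chart_symm_pos c hy)).ne'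
  rw [h, φ.left_inv hx, mul_div_cancel_right₀ _ hp]

variable [IsContMDiffRiemannianBundle (𝓡 d) ∞ (EuclideanSpace ℝ (Fin d))
    (fun x : M => TangentSpace (𝓡 d) x)]

theorem contMDiff_jacobian {F : M → M} (hF : ContMDiff (𝓡 d) (𝓡 d) 2 F)
    (hinj : ∀ (x : M) (v : TangentSpace (𝓡 d) x), mfderiv (𝓡 d) (𝓡 d) F x v = 0 → v = 0) :
    ContMDiff (𝓡 d) 𝓘(ℝ, ℝ) 1 (jacobian (d := d) F) := by
  intro c
  set φ := chartAt (EuclideanSpace ℝ (Fin d)) c with hφ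
  have hF1 : ContMDiff (𝓡 d) (𝓡 d) 1 F := hF.of_le (by norm_num)
  have hc : c ∈ φ.source := mem_chart_source _ c
  have hsymm : ContMDiffOn (𝓡 d) (𝓡 d) 2 φ.symm φ.target :=
    (contMDiffOn_chart_symm (n := ∞)).of_le (by norm_cast)
  have h1 := contDiffOn_paramGram φ.open_target hsymm
  have h2 := contDiffOn_paramGram φ.open_target (hF.comp_contMDiffOn hsymm)
  have hp1 : ∀ y ∈ φ.target, 0 < paramGram φ.symm y := fun y hy => paramGram_chart_symm_pos c hy
  have hp2 : ∀ y ∈ φ.target, 0 < paramGram (F ∘ φ.symm) y := fun y hy => by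
    have h := sqrt_paramGram_map_comp (hF1.mdifferentiable one_ne_zero (φ.symm y))
      (mdifferentiableAt_atlas_symm (I := 𝓡 d) (chart_mem_atlas _ c) hy)
    exact Real.sqrt_pos.1 (h ▸ mul_pos (jacobian_pos (hinj _)) (Real.sqrt_pos.2 (hp1 y hy)))
  have h3 : ContDiffOn ℝ 1
      (fun y => √(paramGram (F ∘ φ.symm) y) / √(paramGram φ.symm y)) φ.target :=
    (h2.sqrt fun y hy => (hp2 y hy).ne').div (h1.sqrt fun y hy => (hp1 y hy).ne')
      fun y hy => (Real.sqrt_pos.2 (hp1 y hy)).ne'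
  have h4 : ContMDiffOn (𝓡 d) 𝓘(ℝ, ℝ) 1
      ((fun y => √(paramGram (F ∘ φ.symm) y) / √(paramGram φ.symm y)) ∘ φ) φ.source :=
    h3.contMDiffOn.comp (contMDiffOn_chart (n := 1)) fun x hx => φ.map_source hx
  have h5 := h4.congr fun x hx => jacobian_eq_div c hF1 hx
  exact h5.contMDiffAt (φ.open_source.mem_nhds hc)

theorem setLIntegral_chartVolume [MeasurableSpace M] [BorelSpace M] (c : M) {A : Set M}
    (hA : MeasurableSet A)
    (hc : A ⊆ (chartAt (EuclideanSpace ℝ (Fin d)) c).source) {f : M → ENNReal}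
    (hf : Measurable f) :
    ∫⁻ x in A, f x ∂(chartVolume (d := d) c) =
      ∫⁻ y in (chartAt (EuclideanSpace ℝ (Fin d)) c) '' A,
        f ((chartAt (EuclideanSpace ℝ (Fin d)) c).symm y) *
        ENNReal.ofReal √(paramGram (chartAt (EuclideanSpace ℝ (Fin d)) c).symm y) := by
  set φ := chartAt (EuclideanSpace ℝ (Fin d)) c with hφ
  have hT := φ.open_target.measurableSet
  have hsymm : ContMDiffOn (𝓡 d) (𝓡 d) 2 φ.symm φ.target :=
    (contMDiffOn_chart_symm (n := ∞)).of_le (by norm_cast)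
  have hw : AEMeasurable (fun y => ENNReal.ofReal √(paramGram φ.symm y))
      (volume.restrict φ.target) :=
    ((contDiffOn_paramGram φ.open_target hsymm).continuousOn.aemeasurable hT).sqrt.ennreal_ofReal
  have hφm : AEMeasurable φ.symm (volume.restrict φ.target) :=
    φ.continuousOn_symm.aemeasurable hT
  have hφm' : AEMeasurable φ.symm (((volume : Measure (EuclideanSpace ℝ (Fin d))).restrict
      φ.target).withDensity fun y => ENNReal.ofReal √(paramGram φ.symm y)) :=
    hφm.mono_ac (withDensity_absolutelyContinuous _ _)
  have hfA := hf.indicator hA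
  have hS := measurableSet_chart_image (d := d) c hA
  rw [← hφ, Set.inter_eq_left.2 hc] at hS
  have himg : φ '' A = φ.target ∩ φ.symm ⁻¹' A := by
    have := φ.image_source_inter_eq' A
    rwa [Set.inter_comm, Set.inter_eq_left.2 hc] at this
  rw [← lintegral_indicator hA, chartVolume]
  simp only [chartGram_det]
  have hfφ : AEMeasurable (fun y => A.indicator f (φ.symm y)) (volume.restrict φ.target) :=
    hfA.comp_aemeasurable hφm
  rw [lintegral_map' hfA.aemeasurable hφm',
    lintegral_withDensity_eq_lintegral_mul₀ hw hfφ,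
    ← lintegral_indicator hT, ← lintegral_indicator hS]
  refine lintegral_congr fun y => ?_
  by_cases hy : y ∈ φ.target <;> by_cases hyA : φ.symm y ∈ A <;> simp [himg, hy, hyA, mul_comm]

/-- On a neighbourhood where `F` is injective, lying in one chart domain and mapped into another,
both sides are integrals over the same coordinate set. -/
theorem exists_nhds_riemannianVolume_image [T2Space M] [MeasurableSpace M] [BorelSpace M]
    {F : M → M}     (hF : ContMDiff (𝓡 d) (𝓡 d) 2 F)
    (hinj : ∀ (x : M) (v : TangentSpace (𝓡 d) x), mfderiv (𝓡 d) (𝓡 d) F x v = 0 → v = 0) (x : M) :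
    ∃ U ∈ nhds x, MeasurableSet U ∧ Set.InjOn F U ∧ ∀ A, MeasurableSet A → A ⊆ U →
      riemannianVolume d M (F '' A) =
        ∫⁻ x in A, ENNReal.ofReal (jacobian (d := d) F x) ∂(riemannianVolume d M) := by
  have hF1 : ContMDiff (𝓡 d) (𝓡 d) 1 F := hF.of_le (by norm_num)
  obtain ⟨e, hx, he, -⟩ := exists_local_inverse hF1 (hinj x)
  set φ := chartAt (EuclideanSpace ℝ (Fin d)) x with hφ
  set φ' := chartAt (EuclideanSpace ℝ (Fin d)) (F x) with hφ'
  have hU : IsOpen (e.source ∩ φ.source ∩ F ⁻¹' φ'.source) :=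
    (e.open_source.inter φ.open_source).inter (φ'.open_source.preimage hF.continuous)
  have hinjU : Set.InjOn F (e.source ∩ φ.source ∩ F ⁻¹' φ'.source) := by
    intro y hy z hz hyz
    rw [he hy.1.1, he hz.1.1] at hyz
    exact e.injOn hy.1.1 hz.1.1 hyz
  refine ⟨_, hU.mem_nhds ⟨⟨hx, mem_chart_source _ x⟩, mem_chart_source _ (F x)⟩,
    hU.measurableSet, hinjU, fun A hA hAU => ?_⟩
  have hAφ : A ⊆ φ.source := fun y hy => (hAU hy).1.2
  have hS := measurableSet_chart_image (d := d) x hA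
  rw [← hφ, Set.inter_eq_left.2 hAφ] at hS
  have hST : ∀ y ∈ φ '' A, y ∈ φ.target ∧ φ.symm y ∈ A := by
    rintro _ ⟨z, hz, rfl⟩
    exact ⟨φ.map_source (hAφ hz), by rwa [φ.left_inv (hAφ hz)]⟩
  have hd : ∀ y ∈ φ '' A, MDifferentiableAt (𝓡 d) (𝓡 d) φ.symm y := fun y hy =>
    mdifferentiableAt_atlas_symm (chart_mem_atlas _ x) (hST y hy).1
  have himg : (F ∘ φ.symm) '' (φ '' A) = F '' A := by
    rw [Set.image_comp, Set.image_image φ.symm φ]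
    congr 1
    exact (Set.image_congr fun y hy => φ.left_inv (hAφ hy)).trans (Set.image_id _)
  have hinj' : Set.InjOn (F ∘ φ.symm) (φ '' A) := fun y hy z hz hyz =>
    φ.symm.injOn (hST y hy).1 (hST z hz).1 (hinjU (hAU (hST y hy).2) (hAU (hST z hz).2) hyz)
  have h1 := chartVolume_image hS (F x) (Φ := F ∘ φ.symm)
    (fun y hy => (hF1.mdifferentiable one_ne_zero _).comp y (hd y hy)) hinj'
    (fun y hy => (hAU (hST y hy).2).2)
  rw [himg] at h1
  have hJm : Measurable fun x => ENNReal.ofReal (jacobian (d := d) F x) :=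
    (contMDiff_jacobian hF hinj).continuous.measurable.ennreal_ofReal
  have hFA : MeasurableSet (F '' A) := by
    rw [← himg]
    refine hS.image_of_continuousOn_injOn (fun y hy => ?_) hinj'
    exact (hF.continuous.continuousAt.comp (hd y hy).continuousAt).continuousWithinAt
  have hres : (riemannianVolume d M).restrict A = (chartVolume (d := d) x).restrict A :=
    Measure.ext fun B hB => by
      rw [Measure.restrict_apply hB, Measure.restrict_apply hB]
      exact riemannianVolume_eq_chartVolume x (hB.inter hA) fun y hy => hAφ hy.2
  rw [riemannianVolume_eq_chartVolume (F x) hFA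
      (Set.image_subset_iff.2 fun y hy => (hAU hy).2), h1, hres,
    setLIntegral_chartVolume x hA hAφ hJm]
  refine setLIntegral_congr_fun hS fun y hy => ?_
  rw [sqrt_paramGram_map_comp (hF1.mdifferentiable one_ne_zero _) (hd y hy),
    ENNReal.ofReal_mul (jacobian_pos (hinj _)).le]

/-- Every nonempty open set has positive Riemannian volume. -/
theorem isOpenPosMeasure_riemannianVolume [MeasurableSpace M] [BorelSpace M] :
    (riemannianVolume d M).IsOpenPosMeasure := by
  refine ⟨fun U hU ⟨c, hc⟩ h0 => ?_⟩
  set φ := chartAt (EuclideanSpace ℝ (Fin d)) c with hφ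
  have hle : chartVolume (d := d) c U = 0 :=
    le_antisymm ((le_iSup (fun c : M => chartVolume (d := d) c) c U).trans h0.le) bot_le
  rw [chartVolume_apply c hU.measurableSet, ← hφ] at hle
  have hopen : IsOpen (φ '' (U ∩ φ.source)) :=
    φ.isOpen_image_of_subset_source (hU.inter φ.open_source) Set.inter_subset_right
  have hsub : φ '' (U ∩ φ.source) ⊆ φ.target := by
    rintro _ ⟨x, hx, rfl⟩
    exact φ.map_source hx.2
  have hsymm : ContMDiffOn (𝓡 d) (𝓡 d) 2 φ.symm φ.target :=
    (contMDiffOn_chart_symm (n := ∞)).of_le (by norm_cast)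
  have hw : AEMeasurable (fun y => ENNReal.ofReal √(paramGram φ.symm y))
      (volume.restrict (φ '' (U ∩ φ.source))) :=
    (((contDiffOn_paramGram φ.open_target hsymm).continuousOn.mono hsub).aemeasurable
      hopen.measurableSet).sqrt.ennreal_ofReal
  rw [lintegral_eq_zero_iff' hw, Filter.EventuallyEq, ae_restrict_iff' hopen.measurableSet] at hle
  have : (volume : Measure (EuclideanSpace ℝ (Fin d))) (φ '' (U ∩ φ.source)) = 0 := by
    refine measure_mono_null (fun y hy => ?_) (ae_iff.1 hle)
    simp only [Set.mem_ofPred_eq, Classical.not_imp]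
    exact ⟨hy, by simpa using Real.sqrt_pos.2 (paramGram_chart_symm_pos c (hsub hy))⟩
  exact (hopen.measure_pos volume ⟨φ c, c, ⟨hc, mem_chart_source _ c⟩, rfl⟩).ne' this

end Jacobian

end

noncomputable section

/-! ### Lipschitz bounds on compact Riemannian manifolds -/

section Compact

open Manifold

attribute [local instance] normedAddCommGroupTangentSpaceVectorSpace
  normedSpaceTangentSpaceVectorSpace

variable {d : ℕ} {M : Type*} [MetricSpace M]
  [ChartedSpace (EuclideanSpace ℝ (Fin d)) M] [IsManifold (𝓡 d) ∞ M]
  [RiemannianBundle (fun x : M => TangentSpace (𝓡 d) x)]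
  [IsContMDiffRiemannianBundle (𝓡 d) ∞ (EuclideanSpace ℝ (Fin d))
    (fun x : M => TangentSpace (𝓡 d) x)]

theorem eventually_norm_mfderiv_chart_apply_le (x : M) :
    ∃ C > 0, ∀ᶠ y in nhds x, ∀ v : TangentSpace (𝓡 d) y,
      ‖(show EuclideanSpace ℝ (Fin d) from
        mfderiv (𝓡 d) 𝓘(ℝ, EuclideanSpace ℝ (Fin d)) (extChartAt (𝓡 d) x) y v)‖ ≤ C * ‖v‖ := by
  have : IsContinuousRiemannianBundle (EuclideanSpace ℝ (Fin d))
      (fun x : M => TangentSpace (𝓡 d) x) := by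
    obtain ⟨g, hg, h⟩ := IsContMDiffRiemannianBundle.exists_contMDiff (IB := 𝓡 d) (n := ∞)
      (F := EuclideanSpace ℝ (Fin d)) (E := fun x : M => TangentSpace (𝓡 d) x)
    exact ⟨g, hg.continuous, h⟩
  obtain ⟨C, hC, h⟩ := eventually_norm_mfderiv_extChartAt_lt (𝓡 d) x
  refine ⟨C, hC, h.mono fun y hy v => ?_⟩
  have := ContinuousLinearMap.le_of_opNorm_le _ hy.le v
  exact this

/-- Factor `g` through the chart at `x`: the coordinate derivative of `g` is continuous and the
derivative of the chart is locally bounded for the Riemannian norms. -/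
theorem eventually_norm_mfderiv_le {g : M → ℝ} (hg : ContMDiff (𝓡 d) 𝓘(ℝ, ℝ) 1 g) (x : M) :
    ∃ K, ∀ᶠ y in nhds x, ∀ v : TangentSpace (𝓡 d) y,
      |(show ℝ from mfderiv (𝓡 d) 𝓘(ℝ, ℝ) g y v)| ≤ K * ‖v‖ := by
  obtain ⟨C, hC, h⟩ := eventually_norm_mfderiv_chart_apply_le (d := d) x
  set φ := chartAt (EuclideanSpace ℝ (Fin d)) x with hφ
  have hx : x ∈ φ.source := mem_chart_source _ x
  have hgφ : ContDiffOn ℝ 1 (g ∘ φ.symm) φ.target :=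
    (hg.comp_contMDiffOn (contMDiffOn_chart_symm (n := 1))).contDiffOn
  have hcont : ContinuousOn (fderiv ℝ (g ∘ φ.symm)) φ.target :=
    hgφ.continuousOn_fderiv_of_isOpen φ.open_target le_rfl
  have hat : ContinuousAt (fun y => ‖fderiv ℝ (g ∘ φ.symm) (φ y)‖) x :=
    ((hcont.continuousAt (φ.open_target.mem_nhds (φ.map_source hx))).comp
      (φ.continuousAt hx)).norm
  set K := ‖fderiv ℝ (g ∘ φ.symm) (φ x)‖ + 1 with hK
  have hK0 : 0 ≤ K := by positivity
  refine ⟨K * C, ?_⟩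
  filter_upwards [h, hat.eventually (gt_mem_nhds (lt_add_one _)),
    φ.open_source.mem_nhds hx] with y h1 h2 hy v
  have hφd : MDifferentiableAt (𝓡 d) 𝓘(ℝ, EuclideanSpace ℝ (Fin d)) (extChartAt (𝓡 d) x) y :=
    mdifferentiableAt_extChartAt hy
  have hgd : DifferentiableAt ℝ (g ∘ φ.symm) (φ y) :=
    (hgφ.differentiableOn one_ne_zero).differentiableAt
      (φ.open_target.mem_nhds (φ.map_source hy))
  have heq : g =ᶠ[nhds y] (g ∘ φ.symm) ∘ extChartAt (𝓡 d) x := by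
    filter_upwards [φ.open_source.mem_nhds hy] with z hz
    exact congrArg g (φ.left_inv hz).symm
  have hd : mfderiv (𝓡 d) 𝓘(ℝ, ℝ) g y v = fderiv ℝ (g ∘ φ.symm) (φ y)
      (show EuclideanSpace ℝ (Fin d) from
        mfderiv (𝓡 d) 𝓘(ℝ, EuclideanSpace ℝ (Fin d)) (extChartAt (𝓡 d) x) y v) := by
    have h3 : HasMFDerivAt 𝓘(ℝ, EuclideanSpace ℝ (Fin d)) 𝓘(ℝ, ℝ) (g ∘ φ.symm)
        (extChartAt (𝓡 d) x y) (fderiv ℝ (g ∘ φ.symm) (φ y)) :=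
      hgd.hasFDerivAt.hasMFDerivAt
    have h4 := (h3.comp y hφd.hasMFDerivAt).congr_of_eventuallyEq heq
    rw [h4.mfderiv]
    rfl
  change ‖(show ℝ from mfderiv (𝓡 d) 𝓘(ℝ, ℝ) g y v)‖ ≤ _
  refine (congrArg (fun r : ℝ => ‖r‖) hd).le.trans ?_
  refine (ContinuousLinearMap.le_of_opNorm_le _ h2.le _).trans ?_
  rw [mul_assoc]
  exact mul_le_mul_of_nonneg_left (h1 v) hK0

end Compact

/-! ### From local derivative bounds to global Lipschitz constants. -/

section Lipschitz

variable {d : ℕ} {M : Type*} [MetricSpace M] [CompactSpace M]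
  [ChartedSpace (EuclideanSpace ℝ (Fin d)) M] [IsManifold (𝓡 d) ∞ M]
  [RiemannianBundle (fun x : M => TangentSpace (𝓡 d) x)]
  [IsContMDiffRiemannianBundle (𝓡 d) ∞ (EuclideanSpace ℝ (Fin d))
    (fun x : M => TangentSpace (𝓡 d) x)]

theorem exists_norm_mfderiv_le {g : M → ℝ} (hg : ContMDiff (𝓡 d) 𝓘(ℝ, ℝ) 1 g) :
    ∃ K, 0 ≤ K ∧ ∀ x, ‖mfderiv (𝓡 d) 𝓘(ℝ, ℝ) g x‖ ≤ K := by
  obtain ⟨K, hK⟩ := isCompact_univ.induction_on (X := M)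
    (p := fun S => ∃ K, ∀ y ∈ S, ∀ v : TangentSpace (𝓡 d) y,
      |(show ℝ from mfderiv (𝓡 d) 𝓘(ℝ, ℝ) g y v)| ≤ K * ‖v‖)
    ⟨0, fun y hy => hy.elim⟩
    (fun s t hst ⟨K, h⟩ => ⟨K, fun y hy => h y (hst hy)⟩)
    (fun s t ⟨K, h⟩ ⟨K', h'⟩ => ⟨max K K', fun y hy v => hy.elim
      (fun hy => (h y hy v).trans (mul_le_mul_of_nonneg_right (le_max_left _ _) (norm_nonneg _)))
      (fun hy => (h' y hy v).trans
        (mul_le_mul_of_nonneg_right (le_max_right _ _) (norm_nonneg _)))⟩)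
    (fun x _ => by
      obtain ⟨K, h⟩ := eventually_norm_mfderiv_le (d := d) hg x
      exact ⟨_, mem_nhdsWithin_of_mem_nhds h, K, fun y hy => hy⟩)
  refine ⟨max K 0, le_max_right _ _, fun x => ?_⟩
  refine ContinuousLinearMap.opNorm_le_bound _ (le_max_right _ _) fun v => ?_
  have h1 : |(show ℝ from mfderiv (𝓡 d) 𝓘(ℝ, ℝ) g x v)| ≤ max K 0 * ‖v‖ :=
    (hK x trivial v).trans (mul_le_mul_of_nonneg_right (le_max_left _ _) (norm_nonneg _))
  rw [norm_tangentSpace_vectorSpace]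
  exact h1

variable [IsRiemannianManifold (𝓡 d) M]

theorem exists_lipschitz_of_contMDiff {g : M → ℝ} (hg : ContMDiff (𝓡 d) 𝓘(ℝ, ℝ) 1 g) :
    ∃ K, 0 ≤ K ∧ ∀ x y, |g x - g y| ≤ K * dist x y := by
  obtain ⟨K, hK, h⟩ := exists_norm_mfderiv_le hg
  exact ⟨K, hK, abs_sub_le_of_norm_mfderiv_le hg h⟩

theorem exists_logLip_of_contMDiff_log {ψ : M → ℝ} (hψ : ∀ x, 0 < ψ x)
    (h : ContMDiff (𝓡 d) 𝓘(ℝ, ℝ) 1 fun x => Real.log (ψ x)) : ∃ C, 0 ≤ C ∧ LogLip C ψ := by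
  obtain ⟨C, hC, h⟩ := exists_lipschitz_of_contMDiff h
  exact ⟨C, hC, LogLip.of_log hψ h⟩

theorem exists_logLip_jacobian {F : M → M} (hF : ContMDiff (𝓡 d) (𝓡 d) 2 F)
    (hinj : ∀ (x : M) (v : TangentSpace (𝓡 d) x), mfderiv (𝓡 d) (𝓡 d) F x v = 0 → v = 0) :
    ∃ C, 0 ≤ C ∧ LogLip C (jacobian (d := d) F) := by
  have hpos : ∀ x, 0 < jacobian (d := d) F x := fun x => jacobian_pos (hinj x)
  refine exists_logLip_of_contMDiff_log (d := d) hpos fun x => ?_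
  have h1 : ContMDiffAt 𝓘(ℝ, ℝ) 𝓘(ℝ, ℝ) 1 Real.log (jacobian (d := d) F x) :=
    (Real.contDiffAt_log.2 (hpos x).ne').contMDiffAt
  exact h1.comp x (contMDiff_jacobian hF hinj x)

end Lipschitz

end

noncomputable section

/-! ### Uniformly expanding families on Riemannian manifolds -/

section Assembly

theorem isFiniteMeasure_of_integral_eq_one {M : Type*} [TopologicalSpace M] [CompactSpace M]
    [Nonempty M] [MeasurableSpace M] [OpensMeasurableSpace M] {μ : Measure M} {ρ : M → ℝ}
    (hρ : Continuous ρ) (hpos : ∀ x, 0 < ρ x) (h1 : ∫ x, ρ x ∂μ = 1) : IsFiniteMeasure μ := by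
  obtain ⟨p, -, hp⟩ := isCompact_univ.exists_isMinOn Set.univ_nonempty hρ.continuousOn
  -- A non-integrable function has integral 0 by convention, which the value 1 excludes.
  have hi : Integrable ρ μ := by
    by_contra h
    rw [integral_undef h] at h1
    exact zero_ne_one h1
  have hc : Integrable (fun _ : M => ρ p) μ :=
    hi.mono' aestronglyMeasurable_const (Filter.Eventually.of_forall fun x => by
      rw [Real.norm_of_nonneg (hpos p).le]
      exact hp (Set.mem_univ x))
  exact (integrable_const_iff_isFiniteMeasure (hpos p).ne').1 hc

theorem exists_nonpos_of_integral_mul_eq_zero {M : Type*} [TopologicalSpace M] [CompactSpace M]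
    [Nonempty M] [MeasurableSpace M] [BorelSpace M] {μ : Measure M} [IsFiniteMeasure μ]
    [μ.IsOpenPosMeasure] {s ρ : M → ℝ} (hs : Continuous s) (hρ : Continuous ρ)
    (hpos : ∀ x, 0 < ρ x) (h0 : ∫ x, s x * ρ x ∂μ = 0) : ∃ x, s x ≤ 0 := by
  by_contra! h
  have hp : ∀ x, 0 < s x * ρ x := fun x => mul_pos (h x) (hpos x)
  obtain ⟨x⟩ := ‹Nonempty M›
  exact ((hs.mul hρ).integral_pos_of_hasCompactSupport_nonneg_nonzero (μ := μ)
    (HasCompactSupport.of_compactSpace _) (fun x => (hp x).le) (hp x).ne').ne' h0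

theorem exists_common_bound {ι : Type*} [Fintype ι] {P : ι → ℝ → Prop}
    (hmono : ∀ i c c', c ≤ c' → P i c → P i c') (h : ∀ i, ∃ c, 0 ≤ c ∧ P i c) :
    ∃ c, 0 ≤ c ∧ ∀ i, P i c := by
  choose c hc hP using h
  exact ⟨∑ i, c i, Finset.sum_nonneg fun i _ => hc i, fun i =>
    hmono i _ _ (Finset.single_le_sum (fun i _ => hc i) (Finset.mem_univ i)) (hP i)⟩

theorem sum_Icc_one_eq_sum_range {R : Type*} [AddCommMonoid R] (f : ℕ → R) (L : ℕ) :
    ∑ i ∈ Finset.Icc 1 L, f i = ∑ i ∈ Finset.range L, f (i + 1) := by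
  have : Finset.Icc 1 L = Finset.Ico (0 + 1) (L + 1) := by
    ext i; simp only [Finset.mem_Icc, Finset.mem_Ico]; omega
  rw [this, Finset.range_eq_Ico, Finset.sum_Ico_add']

theorem centered_sub_centered {M : Type*} [MeasurableSpace M] (μ : Measure M) (ρ : M → ℝ)
    (f : ℕ → M → M) (g : ℕ → M → ℝ) (k : ℕ) (x y : M) :
    centered μ ρ f g k x - centered μ ρ f g k y = g k x - g k y := by
  simp only [centered]; ring

theorem integral_sum_centered_mul_eq_zero {M : Type*} [MetricSpace M] [CompactSpace M]
    [MeasurableSpace M] [BorelSpace M] {μ : Measure M} [IsFiniteMeasure μ] {ρ : M → ℝ}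
    (hρ : Continuous ρ) (h1 : ∫ x, ρ x ∂μ = 1) {f : ℕ → M → M} (hf : ∀ k, Continuous (f k))
    {g : ℕ → M → ℝ} (hg : ∀ k, Continuous (g k)) (s : Finset ℕ) :
    ∫ x, (∑ i ∈ s, centered μ ρ f g i (composeFrom f 0 i x)) * ρ x ∂μ = 0 := by
  have hi : ∀ i, Integrable (fun x => g i (composeFrom f 0 i x) * ρ x) μ := fun i =>
    (((hg i).comp (continuous_composeFrom hf 0 i)).mul hρ).integrable_of_compact
  have hc : ∀ c : ℝ, Integrable (fun x => c * ρ x) μ := fun c =>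
    (continuous_const.mul hρ).integrable_of_compact
  simp only [Finset.sum_mul, centered, sub_mul]
  have hic : ∀ i ∈ s, Integrable (fun x => g i (composeFrom f 0 i x) * ρ x -
      (∫ y, g i (composeFrom f 0 i y) * ρ y ∂μ) * ρ x) μ := fun i _ => (hi i).sub (hc _)
  rw [integral_finsetSum _ hic]
  refine Finset.sum_eq_zero fun i _ => ?_
  rw [integral_sub (hi i) (hc _), integral_const_mul, h1, mul_one, sub_self]

variable {d : ℕ} {M : Type*} [MetricSpace M] [CompactSpace M] [ConnectedSpace M]
  [MeasurableSpace M] [BorelSpace M]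
  [ChartedSpace (EuclideanSpace ℝ (Fin d)) M] [IsManifold (𝓡 d) ∞ M]
  [RiemannianBundle (fun x : M => TangentSpace (𝓡 d) x)]
  [IsContMDiffRiemannianBundle (𝓡 d) ∞ (EuclideanSpace ℝ (Fin d))
    (fun x : M => TangentSpace (𝓡 d) x)]
  [IsRiemannianManifold (𝓡 d) M]

omit [ConnectedSpace M] in
theorem expandingMap_riemannianVolume [IsFiniteMeasure (riemannianVolume d M)] {F : M → M}
    (hF : ContMDiff (𝓡 d) (𝓡 d) 2 F) {θ lam C : ℝ} (hθ : 0 < θ) (hlam : 1 < lam * θ)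
    (hexp : ∀ (x : M) (v : TangentSpace (𝓡 d) x), θ * ‖v‖ ≤ ‖mfderiv (𝓡 d) (𝓡 d) F x v‖)
    (hC : LogLip C (jacobian (d := d) F)) :
    ExpandingMap (riemannianVolume d M) F (jacobian (d := d) F) lam C where
  continuous := hF.continuous
  finite_fiber := finite_fiber_of_locally_injective fun x =>
    (exists_nhds_riemannianVolume_image hF
      (fun x => mfderiv_injective_of_expanding hθ (hexp x)) x).imp fun _ h => ⟨h.1, h.2.2.1⟩
  pairing := exists_fiber_equiv (hF.of_le (by norm_num)) hθ hlam hexp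
  jac := hC
  duality _ _ hφ hψ := integral_comp_mul_eq_integral_mul_transfer hF.continuous hC.continuous hC.1
    (exists_nhds_riemannianVolume_image hF
      fun x => mfderiv_injective_of_expanding hθ (hexp x)) hφ hψ

end Assembly

end

theorem mainTheorem10
    {d : ℕ} {M : Type*} [MetricSpace M] [CompactSpace M] [ConnectedSpace M]
    [MeasurableSpace M] [BorelSpace M]
    [ChartedSpace (EuclideanSpace ℝ (Fin d)) M] [IsManifold (𝓡 d) ∞ M]
    [RiemannianBundle (fun x : M => TangentSpace (𝓡 d) x)]
    [IsContMDiffRiemannianBundle (𝓡 d) ∞ (EuclideanSpace ℝ (Fin d))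
      (fun x : M => TangentSpace (𝓡 d) x)]
    [IsRiemannianManifold (𝓡 d) M]
    -- the finite families of uniformly expanding maps and of observables
    {N : ℕ} (F : Fin N → M → M) (G : Fin N → M → ℝ)
    (hF : ∀ j, ContMDiff (𝓡 d) (𝓡 d) 2 (F j))
    (hexp : ∃ ϑ : ℝ, 1 < ϑ ∧ ∀ (j : Fin N) (x : M) (v : TangentSpace (𝓡 d) x),
      ϑ * ‖v‖ ≤ ‖mfderiv (𝓡 d) (𝓡 d) (F j) x v‖)
    (hG : ∀ j, ContMDiff (𝓡 d) 𝓘(ℝ, ℝ) 1 (G j))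
    -- the initial probability density
    (ρ : M → ℝ) (hρ_pos : ∀ x, 0 < ρ x)
    (hρ_log : ContMDiff (𝓡 d) 𝓘(ℝ, ℝ) 1 (fun x => Real.log (ρ x)))
    (hρ_one : ∫ x, ρ x ∂(riemannianVolume d M) = 1)
    -- the constants
    (a ε : ℝ) (L D : ℕ) (ha : a ∈ Set.Ioo (0 : ℝ) 1) (hε : 0 < ε) (hL : 1 ≤ L)
    (hεG : ∀ (j : Fin N) (x : M), ε * (4 * ‖mfderiv (𝓡 d) 𝓘(ℝ, ℝ) (G j) x‖) ≤ a)
    (hD : HasSpecification F ε L D)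
    (hLD : ∀ (w₁ w₂ : Fin (L + 1) → Fin N), ∀ i ∈ Finset.Icc 1 L, ∀ x : M,
      8 / a * D * |centered (riemannianVolume d M) ρ
        (fun k => F (wordSeq w₁ k)) (fun k => G (wordSeq w₂ k)) i x| ≤ L)
    -- every word has a point with a large centered Birkhoff sum
    (hword : ∀ (w₁ w₂ : Fin (L + 1) → Fin N), ∃ x : M,
      a * L ≤ ∑ i ∈ Finset.Icc 1 L, centered (riemannianVolume d M) ρ
        (fun k => F (wordSeq w₁ k)) (fun k => G (wordSeq w₂ k)) i
        (composeFrom (fun k => F (wordSeq w₁ k)) 0 i x)) :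
    ∃ B : ℝ, 0 < B ∧ ∀ (ωf ωg : ℕ → Fin N) (n : ℕ),
      B * n ≤ sigmaSq (riemannianVolume d M) ρ (fun k => F (ωf k)) (fun k => G (ωg k)) n := by
  obtain ⟨θ, hθ, hexp⟩ := hexp
  have hθ0 : 0 < θ := one_pos.trans hθ
  have ha0 := ha.1
  have hL0 : (0 : ℝ) < L := by exact_mod_cast hL
  obtain ⟨aρ, haρ, hρ⟩ := exists_logLip_of_contMDiff_log (d := d) hρ_pos hρ_log
  have : IsFiniteMeasure (riemannianVolume d M) :=
    isFiniteMeasure_of_integral_eq_one hρ.continuous hρ_pos hρ_one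
  have : (riemannianVolume d M).IsOpenPosMeasure := isOpenPosMeasure_riemannianVolume
  have hinj := fun j x => mfderiv_injective_of_expanding hθ0 (hexp j x)
  obtain ⟨C, hC0, hC⟩ := exists_common_bound (P := fun j c => LogLip c (jacobian (d := d) (F j)))
    (fun _ _ _ h h' => h'.mono h) (fun j => exists_logLip_jacobian (hF j) (hinj j))
  -- The largest derivative bound allowed by `hεG`; as a common Lipschitz constant it gives exactly
  -- `κ * ε = a / 4`.
  set κ := a / (4 * ε) with hκ
  have hκ0 : 0 ≤ κ := by positivity
  have hlip : ∀ j x y, |G j x - G j y| ≤ κ * dist x y := fun j =>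
    abs_sub_le_of_norm_mfderiv_le (hG j) fun x => by
      rw [hκ, le_div_iff₀ (by positivity)]
      linarith [hεG j x]
  have hdiam : ∀ x y : M, dist x y ≤ Metric.diam (Set.univ : Set M) := fun x y =>
    Metric.dist_le_diam_of_mem isCompact_univ.isBounded (Set.mem_univ x) (Set.mem_univ y)
  have hGc : ∀ j, Continuous (G j) := fun j => (hG j).continuous
  have hFc : ∀ j, Continuous (F j) := fun j => (hF j).continuous
  -- Strictly between `θ⁻¹` and 1, to leave the slack used in `exists_fiber_equiv`.
  obtain ⟨lam, hlam0, hlam1, hlam⟩ : ∃ lam : ℝ, 0 ≤ lam ∧ lam < 1 ∧ 1 < lam * θ := by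
    have h1 : θ⁻¹ < 1 := inv_lt_one_of_one_lt₀ hθ
    have h2 : θ⁻¹ * θ = 1 := inv_mul_cancel₀ hθ0.ne'
    have h3 : 0 < θ⁻¹ := inv_pos.2 hθ0
    exact ⟨(1 + θ⁻¹) / 2, by linarith, by linarith, by nlinarith⟩
  have hlam1' : 0 < 1 - lam := sub_pos.2 hlam1
  -- The hypothesis at time 1 of a constant word bounds `D * |ĝ|` by `a * L / 8`; a difference of
  -- two values loses the centering and costs twice that.
  have hgap : ∀ j x y, D * |G j x - G j y| ≤ a * L / 4 := by
    intro j x y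
    have key : ∀ x, D * |centered (riemannianVolume d M) ρ
        (fun k => F (wordSeq (L := L) (fun _ => j) k))
        (fun k => G (wordSeq (L := L) (fun _ => j) k)) 1 x| ≤ a * L / 8 := fun x => by
      have h := hLD (fun _ => j) (fun _ => j) 1 (by simp [hL]) x
      rw [div_mul_eq_mul_div, div_mul_eq_mul_div, div_le_iff₀ ha0] at h
      linarith
    have h1 := centered_sub_centered (riemannianVolume d M) ρ
      (fun k => F (wordSeq (L := L) (fun _ => j) k))
      (fun k => G (wordSeq (L := L) (fun _ => j) k)) 1 x y
    change _ = G j x - G j y at h1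
    rw [← h1]
    have h2 := mul_le_mul_of_nonneg_left (abs_sub (centered (riemannianVolume d M) ρ
      (fun k => F (wordSeq (L := L) (fun _ => j) k))
      (fun k => G (wordSeq (L := L) (fun _ => j) k)) 1 x) (centered (riemannianVolume d M) ρ
      (fun k => F (wordSeq (L := L) (fun _ => j) k))
      (fun k => G (wordSeq (L := L) (fun _ => j) k)) 1 y)) (Nat.cast_nonneg (α := ℝ) D)
    linarith [key x, key y]
  have hpair : ∀ w₁ w₂ : Fin (L + 1) → Fin N, ∃ x y : M, a * L ≤
      ∑ i ∈ Finset.range L, (G (wordSeq w₂ (i + 1))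
          (composeFrom (fun k => F (wordSeq w₁ k)) 0 (i + 1) x) -
        G (wordSeq w₂ (i + 1)) (composeFrom (fun k => F (wordSeq w₁ k)) 0 (i + 1) y)) := by
    intro w₁ w₂
    obtain ⟨x, hx⟩ := hword w₁ w₂
    have hcont : Continuous fun y => ∑ i ∈ Finset.Icc 1 L, centered (riemannianVolume d M) ρ
        (fun k => F (wordSeq w₁ k)) (fun k => G (wordSeq w₂ k)) i
        (composeFrom (fun k => F (wordSeq w₁ k)) 0 i y) :=
      continuous_finsetSum _ fun i _ => ((hGc _).sub continuous_const).comp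
        (continuous_composeFrom (fun k => hFc _) 0 i)
    obtain ⟨y, hy⟩ := exists_nonpos_of_integral_mul_eq_zero hcont hρ.continuous hρ_pos
      (integral_sum_centered_mul_eq_zero hρ.continuous hρ_one (fun k => hFc _) (fun k => hGc _) _)
    refine ⟨x, y, ?_⟩
    have h1 := hx.trans (sub_le_sub_left hy _ |>.trans' (sub_zero _).ge)
    rw [← Finset.sum_sub_distrib, sum_Icc_one_eq_sum_range] at h1
    simpa only [centered_sub_centered] using h1
  -- The cone constant must hold the initial density, whence `aρ`, and satisfy `a_large`, whence the
  -- second summand. The rate `c₀` is the gain `a * L / 4` per block divided by the block length `L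
  -- + D`.
  refine exists_pos_mul_le_sigmaSq (J := fun j => jacobian (d := d) (F j)) (lam := lam) (C := C)
    (a := aρ + 2 * (lam * C) / (1 - lam)) (Gc := κ) (δ := Metric.diam (Set.univ : Set M))
    (c₀ := a * L / 4 / (L + D)) ?_ ?_ (by positivity) ?_
  · intro ωf ωg
    exact
      { expanding := fun k => expandingMap_riemannianVolume (hF _) hθ0 hlam (hexp _) (hC _)
        lam_nonneg := hlam0
        lam_lt_one := hlam1
        C_nonneg := hC0
        a_nonneg := by positivity
        a_large := by
          rw [mul_add, mul_div_cancel₀ _ hlam1'.ne']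
          nlinarith
        density := hρ.mono (le_add_of_nonneg_right (by positivity))
        density_one := hρ_one
        G_nonneg := hκ0
        lipschitz := fun k => hlip _
        diam := hdiam
        diam_nonneg := Metric.diam_nonneg }
  · intro r hr
    have h := fun j => Metric.uniformContinuous_iff.1
      (CompactSpace.uniformContinuous_of_continuous (hFc j)) r hr
    choose r' hr' h using h
    rcases isEmpty_or_nonempty (Fin N) with hN | hN
    · exact ⟨1, one_pos, fun j => hN.elim j⟩
    · refine ⟨Finset.univ.inf' Finset.univ_nonempty r', ?_, fun j x y hxy =>
        h j (hxy.trans_le (Finset.inf'_le _ (Finset.mem_univ j)))⟩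
      exact (Finset.lt_inf'_iff _).2 fun j _ => hr' j
  · intro ωf ωg n s hs
    have h := hD.mul_le_of_birkhoff_sub_le (a := a) hlip hκ0
      (by rw [hκ]; apply le_of_eq; field_simp) hgap hpair
      (c := κ * Metric.diam (Set.univ : Set M))
      (fun j x y => (hlip j x y).trans (mul_le_mul_of_nonneg_left (hdiam x y) hκ0)) ωf ωg n hs
    have hLD0 : (0 : ℝ) < L + D := by positivity
    rw [div_mul_eq_mul_div, div_le_iff₀ hLD0]
    linarith
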